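/- Theorem. Consider programs in the unit-cost real-arithmetic model: finite systems of recursive first-order functions over data built from real numbers, the empty list and pairs, in which each variable access, rational constant, pair allocation or access, exact operation $+,-,\times,\div,\sqrt{\phantom{x}}$ or comparison on reals, test for emptiness, variable binding and function call counts as one step (so each step takes $O(1)$ time on a real RAM with square roots). There are a program and a constant $C$ such that, for every $n\ge 1$ and every list $L$ of $n$ infinite straight lines $l_i=\{(x,y)\in\mathbb R^2 : a_ix+b_iy+c_i=0\}$ with real coefficients and $(a_i,b_i)\neq(0,0)$, the program, given the list of the triples $(a_i,b_i,c_i)$, halts after at most $Cn$ steps and outputs real numbers $x,y,r$ such that (i) $(x,y,r)$ is an optimal solution of the 3-dimensional linear program: minimize $z$ over $(x,y,z)\in\mathbb R^3$ subject to $$\frac{a_ix+b_iy+c_i}{\sqrt{a_i^2+b_i^2}}\le z,\qquad \frac{-a_ix-b_iy-c_i}{\sqrt{a_i^2+b_i^2}}\le z\qquad(i=1,\dots,n);$$ (ii) the circle $K$ with centre $(x,y)$ and radius $r\ge 0$ (a single point if $r=0$) is a minimum touching circle of $L$, that is, it intersects every line of $L$ and has minimum radius among all circles that do so; (iii) $K$,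 traversed once, is a tour of $L$ (a closed continuous curve that meets every line of $L$), and its length is at most $\frac{\pi}{2}$ times the infimum of the lengths of all tours of $L$. In particular, a $\frac{\pi}{2}$-approximate tour visiting $n$ given lines in the plane can be computed in $O(n)$ time. -/

import Mathlib

namespace TSPNLines

/-! ## The plane, lines, tours -/

/-- The Euclidean plane. -/
abbrev Plane : Type := EuclideanSpace ℝ (Fin 2)

/-- A straight line, presented by an equation `a x + b y + c = 0` with `(a, b) ≠ (0, 0)`. -/
structure Line where
  a : ℝ
  b : ℝ
  c : ℝ
  nondegenerate : a ≠ 0 ∨ b ≠ 0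

/-- The set of points of a line. -/
def Line.points (l : Line) : Set Plane := {p | l.a * p 0 + l.b * p 1 + l.c = 0}

/-- A closed continuous curve in the plane, parametrized by `[0, 1]`. -/
def IsClosedCurve (γ : ℝ → Plane) : Prop :=
  ContinuousOn γ (Set.Icc 0 1) ∧ γ 0 = γ 1

/-- A tour of `L`: a closed continuous curve that visits every line of `L`. -/
def IsTour (L : List Line) (γ : ℝ → Plane) : Prop :=
  IsClosedCurve γ ∧ ∀ l ∈ L, ∃ t ∈ Set.Icc (0 : ℝ) 1, γ t ∈ l.points

/-- Euclidean length of the curve `γ` on `[0, 1]` (`∞` if it is not rectifiable). -/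
noncomputable def curveLength (γ : ℝ → Plane) : ENNReal :=
  eVariationOn γ (Set.Icc 0 1)

/-- The optimal length of a tour of `L`. -/
noncomputable def optLength (L : List Line) : ENNReal :=
  ⨅ (γ : ℝ → Plane) (_ : IsTour L γ), curveLength γ

/-- The circle with centre `p` and radius `r`, traversed once counterclockwise. -/
noncomputable def circleCurve (p : Plane) (r : ℝ) (t : ℝ) : Plane :=
  p + r • !₂[Real.cos (2 * Real.pi * t), Real.sin (2 * Real.pi * t)]

/-- The circle with centre `p` and radius `r ≥ 0` (a point when `r = 0`) meets every line
of `L`. -/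
def IsTouchingCircle (L : List Line) (p : Plane) (r : ℝ) : Prop :=
  0 ≤ r ∧ ∀ l ∈ L, (Metric.sphere p r ∩ l.points).Nonempty

/-- A touching circle of minimum radius. -/
def IsMinTouchingCircle (L : List Line) (p : Plane) (r : ℝ) : Prop :=
  IsTouchingCircle L p r ∧ ∀ q s, IsTouchingCircle L q s → r ≤ s

/-- Feasibility in the linear program, in the variables `x, y, z`, with the `2n` constraints
`± (aᵢ x + bᵢ y + cᵢ) / √(aᵢ² + bᵢ²) ≤ z`. -/
def LPFeasible (L : List Line) (x y z : ℝ) : Prop :=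
  ∀ l ∈ L, (l.a * x + l.b * y + l.c) / Real.sqrt (l.a ^ 2 + l.b ^ 2) ≤ z ∧
    (-l.a * x - l.b * y - l.c) / Real.sqrt (l.a ^ 2 + l.b ^ 2) ≤ z

/-- Optimality in the linear program `min z` over the feasible `(x, y, z)`. -/
def LPOptimal (L : List Line) (x y z : ℝ) : Prop :=
  LPFeasible L x y z ∧ ∀ x' y' z', LPFeasible L x' y' z' → z ≤ z'

/-! ## The model of computation

A uniform unit-cost model over the reals. Programs are finite systems of mutually recursive
first-order functions. A datum is a real number, `nil`, or (a pointer to) a pair of data.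
Every evaluation step is one of: reading a local variable, loading a rational constant,
allocating or dereferencing a pair, one exact operation `+ - * / √` on reals, one comparison of
reals, a test for `nil`, binding a local variable, or a function call. The number of local
variables alive in one call is bounded by the text of the program and pairs are shared, never
copied, so each step takes `O(1)` time on a real RAM (with square roots). There is no rounding,
no transcendental operation and no real constant except rational ones. -/

/-- Data: reals, the empty list, and pairs. -/
inductive Val : Type
  | real (x : ℝ)
  | nil
  | pair (u v : Val)

/-- Expressions. `var i` is the `i`-th most recently bound local variable; `letIn e₁ e₂`
evaluates `e₂` with the value of `e₁` bound; `call f e` calls the `f`-th function of the program;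
`ifNil e e₁ e₂` is `e₁` if `e` is `nil` and `e₂` if it is a pair; `ifLe a b e₁ e₂` is `e₁` if
`a ≤ b` and `e₂` otherwise. -/
inductive Expr : Type
  | var (i : ℕ)
  | num (q : ℚ)
  | nil
  | pair (e₁ e₂ : Expr)
  | fst (e : Expr)
  | snd (e : Expr)
  | add (e₁ e₂ : Expr)
  | sub (e₁ e₂ : Expr)
  | mul (e₁ e₂ : Expr)
  | div (e₁ e₂ : Expr)
  | sqrt (e : Expr)
  | ifNil (e e₁ e₂ : Expr)
  | ifLe (a b e₁ e₂ : Expr)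
  | letIn (e₁ e₂ : Expr)
  | call (f : ℕ) (e : Expr)

/-- A program: the list of the bodies of its functions, each with one argument. Function `0` is
the entry point. -/
abbrev Program : Type := List Expr

/-- `Eval P env e v t`: in the program `P`, with local variables `env`, the evaluation of `e`
terminates without error, with value `v`, after exactly `t` steps. There is no rule, hence no
value, for division by zero, the root of a negative number, and ill-typed operations. -/
inductive Eval (P : Program) : List Val → Expr → Val → ℕ → Prop
  | var {env : List Val} {i : ℕ} {v : Val} (h : env[i]? = some v) : Eval P env (.var i) v 1
  | num {env : List Val} {q : ℚ} : Eval P env (.num q) (.real (q : ℝ)) 1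
  | nil {env : List Val} : Eval P env .nil .nil 1
  | pair {env : List Val} {e₁ e₂ : Expr} {u v : Val} {s t : ℕ}
      (h₁ : Eval P env e₁ u s) (h₂ : Eval P env e₂ v t) :
      Eval P env (.pair e₁ e₂) (.pair u v) (s + t + 1)
  | fst {env : List Val} {e : Expr} {u v : Val} {t : ℕ}
      (h : Eval P env e (.pair u v) t) : Eval P env (.fst e) u (t + 1)
  | snd {env : List Val} {e : Expr} {u v : Val} {t : ℕ}
      (h : Eval P env e (.pair u v) t) : Eval P env (.snd e) v (t + 1)
  | add {env : List Val} {e₁ e₂ : Expr} {x y : ℝ} {s t : ℕ}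
      (h₁ : Eval P env e₁ (.real x) s) (h₂ : Eval P env e₂ (.real y) t) :
      Eval P env (.add e₁ e₂) (.real (x + y)) (s + t + 1)
  | sub {env : List Val} {e₁ e₂ : Expr} {x y : ℝ} {s t : ℕ}
      (h₁ : Eval P env e₁ (.real x) s) (h₂ : Eval P env e₂ (.real y) t) :
      Eval P env (.sub e₁ e₂) (.real (x - y)) (s + t + 1)
  | mul {env : List Val} {e₁ e₂ : Expr} {x y : ℝ} {s t : ℕ}
      (h₁ : Eval P env e₁ (.real x) s) (h₂ : Eval P env e₂ (.real y) t) :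
      Eval P env (.mul e₁ e₂) (.real (x * y)) (s + t + 1)
  | div {env : List Val} {e₁ e₂ : Expr} {x y : ℝ} {s t : ℕ}
      (h₁ : Eval P env e₁ (.real x) s) (h₂ : Eval P env e₂ (.real y) t) (hy : y ≠ 0) :
      Eval P env (.div e₁ e₂) (.real (x / y)) (s + t + 1)
  | sqrt {env : List Val} {e : Expr} {x : ℝ} {t : ℕ}
      (h : Eval P env e (.real x) t) (hx : 0 ≤ x) :
      Eval P env (.sqrt e) (.real (Real.sqrt x)) (t + 1)
  | ifNil_nil {env : List Val} {e e₁ e₂ : Expr} {v : Val} {s t : ℕ}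
      (h : Eval P env e .nil s) (h₁ : Eval P env e₁ v t) :
      Eval P env (.ifNil e e₁ e₂) v (s + t + 1)
  | ifNil_pair {env : List Val} {e e₁ e₂ : Expr} {u w v : Val} {s t : ℕ}
      (h : Eval P env e (.pair u w) s) (h₂ : Eval P env e₂ v t) :
      Eval P env (.ifNil e e₁ e₂) v (s + t + 1)
  | ifLe_true {env : List Val} {a b e₁ e₂ : Expr} {x y : ℝ} {v : Val} {r s t : ℕ}
      (ha : Eval P env a (.real x) r) (hb : Eval P env b (.real y) s) (hxy : x ≤ y)
      (h₁ : Eval P env e₁ v t) : Eval P env (.ifLe a b e₁ e₂) v (r + s + t + 1)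
  | ifLe_false {env : List Val} {a b e₁ e₂ : Expr} {x y : ℝ} {v : Val} {r s t : ℕ}
      (ha : Eval P env a (.real x) r) (hb : Eval P env b (.real y) s) (hxy : y < x)
      (h₂ : Eval P env e₂ v t) : Eval P env (.ifLe a b e₁ e₂) v (r + s + t + 1)
  | letIn {env : List Val} {e₁ e₂ : Expr} {u v : Val} {s t : ℕ}
      (h₁ : Eval P env e₁ u s) (h₂ : Eval P (u :: env) e₂ v t) :
      Eval P env (.letIn e₁ e₂) v (s + t + 1)
  | call {env : List Val} {f : ℕ} {e body : Expr} {u v : Val} {s t : ℕ}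
      (h : Eval P env e u s) (hf : P[f]? = some body) (hb : Eval P [u] body v t) :
      Eval P env (.call f e) v (s + t + 1)

/-- Evaluation is deterministic: value and number of steps are determined. -/
theorem Eval.deterministic {P : Program} {env : List Val} {e : Expr} {v : Val} {t : ℕ}
    (h : Eval P env e v t) : ∀ {v' : Val} {t' : ℕ}, Eval P env e v' t' → v = v' ∧ t = t' := by
  induction h with
  | var h => intro v' t' h'; cases h' with | var h₂ => simp_all
  | num => intro v' t' h'; cases h'; exact ⟨rfl, rfl⟩
  | nil => intro v' t' h'; cases h'; exact ⟨rfl, rfl⟩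
  | pair _ _ i₁ i₂ =>
    intro v' t' h'
    cases h' with | pair k₁ k₂ => have := i₁ k₁; have := i₂ k₂; simp_all
  | fst _ i => intro v' t' h'; cases h' with | fst k => have := i k; simp_all
  | snd _ i => intro v' t' h'; cases h' with | snd k => have := i k; simp_all
  | add _ _ i₁ i₂ =>
    intro v' t' h'
    cases h' with | add k₁ k₂ => have := i₁ k₁; have := i₂ k₂; simp_all
  | sub _ _ i₁ i₂ =>
    intro v' t' h'
    cases h' with | sub k₁ k₂ => have := i₁ k₁; have := i₂ k₂; simp_all
  | mul _ _ i₁ i₂ =>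
    intro v' t' h'
    cases h' with | mul k₁ k₂ => have := i₁ k₁; have := i₂ k₂; simp_all
  | div _ _ _ i₁ i₂ =>
    intro v' t' h'
    cases h' with | div k₁ k₂ _ => have := i₁ k₁; have := i₂ k₂; simp_all
  | sqrt _ _ i => intro v' t' h'; cases h' with | sqrt k _ => have := i k; simp_all
  | ifNil_nil _ _ i₁ i₂ =>
    intro v' t' h'
    cases h' with
    | ifNil_nil k₁ k₂ => have := i₁ k₁; have := i₂ k₂; simp_all
    | ifNil_pair k₁ k₂ => have := i₁ k₁; simp_all
  | ifNil_pair _ _ i₁ i₂ =>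
    intro v' t' h'
    cases h' with
    | ifNil_nil k₁ k₂ => have := i₁ k₁; simp_all
    | ifNil_pair k₁ k₂ => have := i₁ k₁; have := i₂ k₂; simp_all
  | ifLe_true _ _ hxy _ i₁ i₂ i₃ =>
    intro v' t' h'
    cases h' with
    | ifLe_true k₁ k₂ _ k₃ => have := i₁ k₁; have := i₂ k₂; have := i₃ k₃; simp_all
    | ifLe_false k₁ k₂ hlt _ =>
      have e₁ := (i₁ k₁).1; have e₂ := (i₂ k₂).1
      injection e₁ with e₁; injection e₂ with e₂; subst e₁ e₂
      exact absurd hxy (not_le.mpr hlt)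
  | ifLe_false _ _ hxy _ i₁ i₂ i₃ =>
    intro v' t' h'
    cases h' with
    | ifLe_true k₁ k₂ hle _ =>
      have e₁ := (i₁ k₁).1; have e₂ := (i₂ k₂).1
      injection e₁ with e₁; injection e₂ with e₂; subst e₁ e₂
      exact absurd hle (not_le.mpr hxy)
    | ifLe_false k₁ k₂ _ k₃ => have := i₁ k₁; have := i₂ k₂; have := i₃ k₃; simp_all
  | letIn _ _ i₁ i₂ =>
    intro v' t' h'
    cases h' with
    | letIn k₁ k₂ =>
      obtain ⟨rfl, rfl⟩ := i₁ k₁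
      obtain ⟨rfl, rfl⟩ := i₂ k₂
      exact ⟨rfl, rfl⟩
  | call _ hf _ i₁ i₂ =>
    intro v' t' h'
    cases h' with
    | call k₁ kf k₂ =>
      obtain ⟨rfl, rfl⟩ := i₁ k₁
      rw [hf] at kf
      obtain rfl := Option.some.inj kf
      obtain ⟨rfl, rfl⟩ := i₂ k₂
      exact ⟨rfl, rfl⟩

/-- On the argument `input`, the program halts with result `output` after exactly `t` steps. -/
def RunsIn (P : Program) (input output : Val) (t : ℕ) : Prop :=
  ∃ body, P[0]? = some body ∧ Eval P [input] body output t

/-- The input: the list of the coefficient triples of the lines. -/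
def encodeLines : List Line → Val
  | [] => .nil
  | l :: L => .pair (.pair (.real l.a) (.pair (.real l.b) (.real l.c))) (encodeLines L)

/-- The output: the coordinates of the centre, and the radius, of a circle. -/
def encodeCircle (x y r : ℝ) : Val := .pair (.real x) (.pair (.real y) (.real r))

end TSPNLines

/-! Geometry. A circle about `p` meets a line exactly when its radius is at least the distance from
`p` to the line, so minimum touching circles are the optima of the linear program. A closed curve of
length ℓ lies in a disc of radius ℓ/4, centred midway between two points that halve the curve
(`exists_disc_of_isClosedCurve`). For a tour, the boundary of this disc touches every line, hence 4r
≤ ℓ for the minimum radius r (`ofReal_le_optLength`), while the circle has length at most 2πr =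
(π/2)·4r.

Algorithm. The program is solved in linear time by a derandomized form of Clarkson's algorithm. Four
constraints `Q`, from two crossing lines, keep the sublevel sets bounded, and ties are broken
lexicographically, so the optimum exists and is unique; by Helly's theorem at most four constraints
determine it (`IsLexMin.exists_basis`). Start from a small `N ⊆ H` such that every point satisfying
`N` violates at most 1/200 of `H`. Four times, add the constraints violated by the optimum of the
current subset: each round that does not start at the true optimum gains a new member of the basis,
so four rounds suffice (`lexMin_augment_iterate`). For long `H` these subsets have at most |H|/32
members, so the five recursive calls cost a fixed fraction of the time allowed for `H`, and the
total is linear (`exists_program`).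

The set `N` is a union of nets of groups of a constant size `g`. Violation sets shatter at most four
constraints (Radon), hence there are only polynomially many of them (Sauer–Shelah), and a greedy
choice hits all large ones with `g`/100 elements (`exists_small_nets`). Because `g` is constant,
finding a net of a group, and likewise solving a program of bounded size, is a finite case
distinction made by Fourier–Motzkin elimination or by enumeration of vertices. Only the existence of
these constant-time expressions is proved; they are not written out. -/

open TSPNLines
namespace LineTour

/-! ## Evaluation within a time bound -/

/-- The evaluation of `e` terminates with value `v` after at most `T` steps. -/
def EvalLe (P : Program) (env : List Val) (e : Expr) (v : Val) (T : ℕ) : Prop :=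
  ∃ s ≤ T, Eval P env e v s

namespace EvalLe

variable {P : Program} {env : List Val}

theorem mono {e : Expr} {v : Val} {S T : ℕ} (h : EvalLe P env e v S) (hST : S ≤ T) :
    EvalLe P env e v T :=
  let ⟨s, hs, he⟩ := h; ⟨s, hs.trans hST, he⟩

theorem var {i : ℕ} {v : Val} (h : env[i]? = some v) : EvalLe P env (.var i) v 1 :=
  ⟨1, le_rfl, .var h⟩

theorem num {q : ℚ} : EvalLe P env (.num q) (.real (q : ℝ)) 1 := ⟨1, le_rfl, .num⟩

theorem nil : EvalLe P env .nil .nil 1 := ⟨1, le_rfl, .nil⟩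

theorem pair {e₁ e₂ : Expr} {u v : Val} {S T : ℕ} (h₁ : EvalLe P env e₁ u S)
    (h₂ : EvalLe P env e₂ v T) : EvalLe P env (.pair e₁ e₂) (.pair u v) (S + T + 1) :=
  let ⟨_, _, h₁⟩ := h₁; let ⟨_, _, h₂⟩ := h₂; ⟨_, by omega, .pair h₁ h₂⟩

theorem fst {e : Expr} {u v : Val} {T : ℕ} (h : EvalLe P env e (.pair u v) T) :
    EvalLe P env (.fst e) u (T + 1) :=
  let ⟨_, _, h⟩ := h; ⟨_, by omega, .fst h⟩

theorem snd {e : Expr} {u v : Val} {T : ℕ} (h : EvalLe P env e (.pair u v) T) :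
    EvalLe P env (.snd e) v (T + 1) :=
  let ⟨_, _, h⟩ := h; ⟨_, by omega, .snd h⟩

theorem add {e₁ e₂ : Expr} {x y : ℝ} {S T : ℕ} (h₁ : EvalLe P env e₁ (.real x) S)
    (h₂ : EvalLe P env e₂ (.real y) T) :
    EvalLe P env (.add e₁ e₂) (.real (x + y)) (S + T + 1) :=
  let ⟨_, _, h₁⟩ := h₁; let ⟨_, _, h₂⟩ := h₂; ⟨_, by omega, .add h₁ h₂⟩

theorem sub {e₁ e₂ : Expr} {x y : ℝ} {S T : ℕ} (h₁ : EvalLe P env e₁ (.real x) S)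
    (h₂ : EvalLe P env e₂ (.real y) T) :
    EvalLe P env (.sub e₁ e₂) (.real (x - y)) (S + T + 1) :=
  let ⟨_, _, h₁⟩ := h₁; let ⟨_, _, h₂⟩ := h₂; ⟨_, by omega, .sub h₁ h₂⟩

theorem mul {e₁ e₂ : Expr} {x y : ℝ} {S T : ℕ} (h₁ : EvalLe P env e₁ (.real x) S)
    (h₂ : EvalLe P env e₂ (.real y) T) :
    EvalLe P env (.mul e₁ e₂) (.real (x * y)) (S + T + 1) :=
  let ⟨_, _, h₁⟩ := h₁; let ⟨_, _, h₂⟩ := h₂; ⟨_, by omega, .mul h₁ h₂⟩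

theorem div {e₁ e₂ : Expr} {x y : ℝ} {S T : ℕ} (h₁ : EvalLe P env e₁ (.real x) S)
    (h₂ : EvalLe P env e₂ (.real y) T) (hy : y ≠ 0) :
    EvalLe P env (.div e₁ e₂) (.real (x / y)) (S + T + 1) :=
  let ⟨_, _, h₁⟩ := h₁; let ⟨_, _, h₂⟩ := h₂; ⟨_, by omega, .div h₁ h₂ hy⟩

theorem sqrt {e : Expr} {x : ℝ} {T : ℕ} (h : EvalLe P env e (.real x) T) (hx : 0 ≤ x) :
    EvalLe P env (.sqrt e) (.real (Real.sqrt x)) (T + 1) :=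
  let ⟨_, _, h⟩ := h; ⟨_, by omega, .sqrt h hx⟩

theorem ifNil_nil {e e₁ e₂ : Expr} {v : Val} {S T : ℕ} (h : EvalLe P env e .nil S)
    (h₁ : EvalLe P env e₁ v T) : EvalLe P env (.ifNil e e₁ e₂) v (S + T + 1) :=
  let ⟨_, _, h⟩ := h; let ⟨_, _, h₁⟩ := h₁; ⟨_, by omega, .ifNil_nil h h₁⟩

theorem ifNil_pair {e e₁ e₂ : Expr} {u w v : Val} {S T : ℕ}
    (h : EvalLe P env e (.pair u w) S) (h₂ : EvalLe P env e₂ v T) :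
    EvalLe P env (.ifNil e e₁ e₂) v (S + T + 1) :=
  let ⟨_, _, h⟩ := h; let ⟨_, _, h₂⟩ := h₂; ⟨_, by omega, .ifNil_pair h h₂⟩

theorem ifLe_true {a b e₁ e₂ : Expr} {x y : ℝ} {v : Val} {R S T : ℕ}
    (ha : EvalLe P env a (.real x) R) (hb : EvalLe P env b (.real y) S) (hxy : x ≤ y)
    (h₁ : EvalLe P env e₁ v T) : EvalLe P env (.ifLe a b e₁ e₂) v (R + S + T + 1) :=
  let ⟨_, _, ha⟩ := ha; let ⟨_, _, hb⟩ := hb; let ⟨_, _, h₁⟩ := h₁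
  ⟨_, by omega, .ifLe_true ha hb hxy h₁⟩

theorem ifLe_false {a b e₁ e₂ : Expr} {x y : ℝ} {v : Val} {R S T : ℕ}
    (ha : EvalLe P env a (.real x) R) (hb : EvalLe P env b (.real y) S) (hxy : y < x)
    (h₂ : EvalLe P env e₂ v T) : EvalLe P env (.ifLe a b e₁ e₂) v (R + S + T + 1) :=
  let ⟨_, _, ha⟩ := ha; let ⟨_, _, hb⟩ := hb; let ⟨_, _, h₂⟩ := h₂
  ⟨_, by omega, .ifLe_false ha hb hxy h₂⟩

theorem letIn {e₁ e₂ : Expr} {u v : Val} {S T : ℕ} (h₁ : EvalLe P env e₁ u S)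
    (h₂ : EvalLe P (u :: env) e₂ v T) : EvalLe P env (.letIn e₁ e₂) v (S + T + 1) :=
  let ⟨_, _, h₁⟩ := h₁; let ⟨_, _, h₂⟩ := h₂; ⟨_, by omega, .letIn h₁ h₂⟩

theorem call {f : ℕ} {e body : Expr} {u v : Val} {S T : ℕ} (h : EvalLe P env e u S)
    (hf : P[f]? = some body) (hb : EvalLe P [u] body v T) :
    EvalLe P env (.call f e) v (S + T + 1) :=
  let ⟨_, _, h⟩ := h; let ⟨_, _, hb⟩ := hb; ⟨_, by omega, .call h hf hb⟩

end EvalLe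

/-! ## Functions computed in constant time, independently of the program -/

/-- `f` is computed, on the environments `env a`, by one expression, in bounded time, in every
program. -/
def UC {α : Type} (env : α → List Val) (f : α → Val) : Prop :=
  ∃ e T, ∀ P a, EvalLe P (env a) e (f a) T

/-- A real function computed in constant time. -/
def UR {α : Type} (env : α → List Val) (f : α → ℝ) : Prop := UC env fun a => .real (f a)

open Classical in
/-- A predicate decided in constant time. -/
def UD {α : Type} (env : α → List Val) (φ : α → Prop) : Prop :=
  UR env fun a => if φ a then 1 else 0

section
variable {α : Type} {env : α → List Val}

theorem UC.nil : UC env fun _ => .nil := ⟨.nil, 1, fun _ _ => .nil⟩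

theorem UC.pair {f g : α → Val} (hf : UC env f) (hg : UC env g) :
    UC env fun a => .pair (f a) (g a) :=
  let ⟨_, _, hf⟩ := hf; let ⟨_, _, hg⟩ := hg
  ⟨_, _, fun P a => (hf P a).pair (hg P a)⟩

theorem UC.fst {f g : α → Val} (h : UC env fun a => .pair (f a) (g a)) : UC env f :=
  let ⟨_, _, h⟩ := h; ⟨_, _, fun P a => (h P a).fst⟩

theorem UC.snd {f g : α → Val} (h : UC env fun a => .pair (f a) (g a)) : UC env g :=
  let ⟨_, _, h⟩ := h; ⟨_, _, fun P a => (h P a).snd⟩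

theorem UC.ifLe {f g : α → ℝ} {u v : α → Val} (hf : UR env f) (hg : UR env g)
    (hu : UC env u) (hv : UC env v) : UC env fun a => if f a ≤ g a then u a else v a := by
  obtain ⟨e₁, T₁, h₁⟩ := hf
  obtain ⟨e₂, T₂, h₂⟩ := hg
  obtain ⟨e₃, T₃, h₃⟩ := hu
  obtain ⟨e₄, T₄, h₄⟩ := hv
  refine ⟨.ifLe e₁ e₂ e₃ e₄, T₁ + T₂ + (T₃ + T₄) + 1, fun P a => ?_⟩
  by_cases h : f a ≤ g a
  · simp only [h, if_true]
    exact (EvalLe.ifLe_true (h₁ P a) (h₂ P a) h (h₃ P a)).mono (by omega)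
  · simp only [h, if_false]
    exact (EvalLe.ifLe_false (h₁ P a) (h₂ P a) (not_le.1 h) (h₄ P a)).mono (by omega)

theorem UR.const (q : ℚ) : UR env fun _ => (q : ℝ) := ⟨.num q, 1, fun _ _ => .num⟩

theorem UR.zero : UR env fun _ => (0 : ℝ) := by simpa using UR.const (env := env) 0

theorem UR.one : UR env fun _ => (1 : ℝ) := by simpa using UR.const (env := env) 1

theorem UR.add {f g : α → ℝ} (hf : UR env f) (hg : UR env g) : UR env fun a => f a + g a :=
  let ⟨_, _, hf⟩ := hf; let ⟨_, _, hg⟩ := hg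
  ⟨_, _, fun P a => (hf P a).add (hg P a)⟩

theorem UR.sub {f g : α → ℝ} (hf : UR env f) (hg : UR env g) : UR env fun a => f a - g a :=
  let ⟨_, _, hf⟩ := hf; let ⟨_, _, hg⟩ := hg
  ⟨_, _, fun P a => (hf P a).sub (hg P a)⟩

theorem UR.mul {f g : α → ℝ} (hf : UR env f) (hg : UR env g) : UR env fun a => f a * g a :=
  let ⟨_, _, hf⟩ := hf; let ⟨_, _, hg⟩ := hg
  ⟨_, _, fun P a => (hf P a).mul (hg P a)⟩

theorem UR.div {f g : α → ℝ} (hf : UR env f) (hg : UR env g) : UR env fun a => f a / g a := by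
  obtain ⟨e₁, T₁, h₁⟩ := hf
  obtain ⟨e₂, T₂, h₂⟩ := hg
  -- The model has no value for a division by zero, so the divisor is tested first and 0 is returned
  -- there, in agreement with `div_zero`.
  refine ⟨.ifLe e₂ (.num 0) (.ifLe (.num 0) e₂ (.num 0) (.div e₁ e₂)) (.div e₁ e₂),
    T₂ + 1 + (1 + T₂ + 1 + (T₁ + T₂ + 1) + 1) + 1, fun P a => ?_⟩
  have h0 : EvalLe P (env a) (.num 0) (.real (0 : ℝ)) 1 := by
    simpa using EvalLe.num (P := P) (env := env a) (q := 0)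
  rcases lt_trichotomy (g a) 0 with h | h | h
  · exact ((h₂ P a).ifLe_true h0 h.le
      (h0.ifLe_false (h₂ P a) h ((h₁ P a).div (h₂ P a) h.ne))).mono (by omega)
  · simp only [h, div_zero]
    exact ((h₂ P a).ifLe_true h0 h.le (h0.ifLe_true (h₂ P a) h.ge h0)).mono (by omega)
  · exact ((h₂ P a).ifLe_false h0 h ((h₁ P a).div (h₂ P a) h.ne')).mono (by omega)

theorem UD.congr {φ ψ : α → Prop} (h : UD env φ) (hφ : ∀ a, φ a ↔ ψ a) : UD env ψ := by
  rwa [show ψ = φ from funext fun a => propext (hφ a).symm]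

theorem UC.ite {φ : α → Prop} [∀ a, Decidable (φ a)] {u v : α → Val}
    (h : UD env φ) (hu : UC env u) (hv : UC env v) :
    UC env fun a => if φ a then u a else v a := by
  -- The test 1 ≤ (indicator of `φ`) holds exactly when `φ` does.
  have := UC.ifLe UR.one h hu hv
  refine (congrArg (UC env) (funext fun a => ?_)).mp this
  by_cases hφ : φ a <;> simp [hφ]

theorem UR.ite {φ : α → Prop} [∀ a, Decidable (φ a)] {u v : α → ℝ}
    (h : UD env φ) (hu : UR env u) (hv : UR env v) :
    UR env fun a => if φ a then u a else v a := by
  have := UC.ite h hu hv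
  refine (congrArg (UC env) (funext fun a => ?_)).mp this
  by_cases hφ : φ a <;> simp [hφ]

theorem UD.le {f g : α → ℝ} (hf : UR env f) (hg : UR env g) : UD env fun a => f a ≤ g a := by
  have := UC.ifLe hf hg UR.one UR.zero
  refine (congrArg (UC env) (funext fun a => ?_)).mp this
  by_cases hφ : f a ≤ g a <;> simp [hφ]

open Classical in
theorem UD.not {φ : α → Prop} (h : UD env φ) : UD env fun a => ¬ φ a := by
  have := UR.ite h UR.zero UR.one
  refine (congrArg (UR env) (funext fun a => ?_)).mp this
  by_cases hφ : φ a <;> simp [hφ]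

open Classical in
theorem UD.and {φ ψ : α → Prop} (h : UD env φ) (h' : UD env ψ) :
    UD env fun a => φ a ∧ ψ a := by
  have := UR.ite h h' UR.zero
  refine (congrArg (UR env) (funext fun a => ?_)).mp this
  by_cases hφ : φ a <;> by_cases hψ : ψ a <;> simp [hφ, hψ]

theorem UD.or {φ ψ : α → Prop} (h : UD env φ) (h' : UD env ψ) :
    UD env fun a => φ a ∨ ψ a :=
  (h.not.and h'.not).not.congr fun a => by tauto

theorem UD.imp {φ ψ : α → Prop} (h : UD env φ) (h' : UD env ψ) :
    UD env fun a => φ a → ψ a :=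
  (h.not.or h').congr fun a => by tauto

theorem UD.lt {f g : α → ℝ} (hf : UR env f) (hg : UR env g) : UD env fun a => f a < g a :=
  (UD.le hg hf).not.congr fun _ => not_le

theorem UD.eq {f g : α → ℝ} (hf : UR env f) (hg : UR env g) : UD env fun a => f a = g a :=
  ((UD.le hf hg).and (UD.le hg hf)).congr fun _ => le_antisymm_iff.symm

theorem UD.true : UD env fun _ => True := by simpa [UD] using UR.one (env := env)

theorem UD.const (p : Prop) : UD env fun _ => p := by
  by_cases h : p
  · exact UD.true.congr fun _ => by simp [h]
  · exact UD.true.not.congr fun _ => by simp [h]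

theorem UD.forall {ι : Type} [Finite ι] {φ : ι → α → Prop} (h : ∀ i, UD env (φ i)) :
    UD env fun a => ∀ i, φ i a := by
  have := Fintype.ofFinite ι
  suffices ∀ s : Finset ι, UD env fun a => ∀ i ∈ s, φ i a from
    (this Finset.univ).congr fun a => by simp
  intro s
  classical
  induction s using Finset.induction_on with
  | empty => exact UD.true.congr fun _ => by simp
  | insert i s _ ih => exact ((h i).and ih).congr fun _ => by simp

/-- A value can be selected, in constant time, by the first valid one of finitely many
predicates. -/
theorem UC.select {ι : Type} [Finite ι] {φ : ι → α → Prop} {f : ι → α → Val}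
    (hφ : ∀ i, UD env (φ i)) (hf : ∀ i, UC env (f i)) :
    ∃ F, UC env F ∧ ∀ a, (∃ i, φ i a) → ∃ i, φ i a ∧ F a = f i a := by
  have := Fintype.ofFinite ι
  suffices ∀ s : Finset ι, ∃ F, UC env F ∧
      ∀ a, (∃ i ∈ s, φ i a) → ∃ i, φ i a ∧ F a = f i a by
    obtain ⟨F, h, h'⟩ := this Finset.univ
    exact ⟨F, h, fun a ⟨i, hi⟩ => h' a ⟨i, Finset.mem_univ _, hi⟩⟩
  intro s
  classical
  induction s using Finset.induction_on with
  | empty => exact ⟨_, UC.nil, fun a => by simp⟩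
  | insert i s _ ih =>
    obtain ⟨F, hF, h⟩ := ih
    refine ⟨_, UC.ite (hφ i) (hf i) hF, fun a ha => ?_⟩
    by_cases hi : φ i a
    · exact ⟨i, hi, by simp [hi]⟩
    · obtain ⟨j, hj, hja⟩ := ha
      obtain rfl | hj := Finset.mem_insert.1 hj
      · exact absurd hja hi
      · obtain ⟨k, hk, hk'⟩ := h a ⟨j, hj, hja⟩
        exact ⟨k, hk, by simp [hi, hk']⟩

/-! ### Fourier–Motzkin elimination -/

/-- The inequalities with `b j > 0` are strict lower bounds for `y`, those with `b j < 0` strict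
upper bounds. Being finitely many, they leave room for `y` as soon as each lower bound lies below
each upper bound. -/
theorem exists_forall_pos_iff {ι : Type*} [Finite ι] (b u : ι → ℝ) :
    (∃ y, ∀ j, 0 < b j * y + u j) ↔
      (∀ j, b j = 0 → 0 < u j) ∧
        ∀ j k, 0 < b j → b k < 0 → 0 < b j * u k - b k * u j := by
  constructor
  · rintro ⟨y, hy⟩
    refine ⟨fun j hj => by simpa [hj] using hy j, fun j k hj hk => ?_⟩
    nlinarith [mul_pos hj (hy k), mul_pos (neg_pos.2 hk) (hy j)]
  · rintro ⟨h0, h⟩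
    obtain ⟨y, hl, hu⟩ : ∃ y, (∀ j, 0 < b j → -u j / b j < y) ∧
        ∀ k, b k < 0 → y < -u k / b k := by
      obtain ⟨y, hl, hu⟩ := Set.Finite.exists_between'
        (Set.toFinite ((fun j => -u j / b j) '' {j | 0 < b j}))
        (Set.toFinite ((fun j => -u j / b j) '' {j | b j < 0})) (by
          rintro _ ⟨j, hj, rfl⟩ _ ⟨k, hk, rfl⟩
          have hj : 0 < b j := hj
          have hk : b k < 0 := hk
          have := h j k hj hk
          simp only
          rw [div_lt_iff₀ hj, div_mul_eq_mul_div, lt_div_iff_of_neg hk]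
          linarith)
      exact ⟨y, fun j hj => hl _ ⟨j, hj, rfl⟩, fun j hj => hu _ ⟨j, hj, rfl⟩⟩
    refine ⟨y, fun j => ?_⟩
    rcases lt_trichotomy (b j) 0 with hj | hj | hj
    · have := (lt_div_iff_of_neg hj).1 (hu j hj)
      linarith
    · simpa [hj] using h0 j hj
    · have := (div_lt_iff₀ hj).1 (hl j hj)
      linarith

theorem UD.exists_forall_pos {ι : Type} [Finite ι] {a c : ι → α → ℝ} (ha : ∀ j, UR env (a j))
    (hc : ∀ j, UR env (c j)) : UD env fun s => ∃ x, ∀ j, 0 < a j s * x + c j s := by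
  refine UD.congr (.and
    (UD.forall fun j => .imp (UD.eq (ha j) UR.zero) (UD.lt UR.zero (hc j)))
    (UD.forall fun j => UD.forall fun k => .imp (UD.lt UR.zero (ha j))
      (.imp (UD.lt (ha k) UR.zero)
        (UD.lt UR.zero (((ha j).mul (hc k)).sub ((ha k).mul (hc j))))))) fun s => ?_
  exact (exists_forall_pos_iff (fun j => a j s) fun j => c j s).symm

theorem UD.exists_exists_forall_pos {ι : Type} [Finite ι] {a b c : ι → α → ℝ}
    (ha : ∀ j, UR env (a j)) (hb : ∀ j, UR env (b j)) (hc : ∀ j, UR env (c j)) :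
    UD env fun s => ∃ x y, ∀ j, 0 < a j s * x + b j s * y + c j s := by
  classical
  -- Elimination of `y`. Which inequalities and pairs survive depends on signs that vary with `s`;
  -- to keep the index type fixed, the others are replaced by the trivial `0 * x + 1 > 0`.
  have key := UD.exists_forall_pos (env := env) (ι := ι ⊕ ι × ι)
    (a := Sum.elim (fun j s => if b j s = 0 then a j s else 0) fun p s =>
      if 0 < b p.1 s ∧ b p.2 s < 0 then b p.1 s * a p.2 s - b p.2 s * a p.1 s else 0)
    (c := Sum.elim (fun j s => if b j s = 0 then c j s else 1) fun p s =>
      if 0 < b p.1 s ∧ b p.2 s < 0 then b p.1 s * c p.2 s - b p.2 s * c p.1 s else 1)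
    (by
      rintro (j | ⟨j, k⟩)
      · simpa using UR.ite (UD.eq (hb j) UR.zero) (ha j) UR.zero
      · simpa using UR.ite (.and (UD.lt UR.zero (hb j)) (UD.lt (hb k) UR.zero))
          (((hb j).mul (ha k)).sub ((hb k).mul (ha j))) UR.zero)
    (by
      rintro (j | ⟨j, k⟩)
      · simpa using UR.ite (UD.eq (hb j) UR.zero) (hc j) UR.one
      · simpa using UR.ite (.and (UD.lt UR.zero (hb j)) (UD.lt (hb k) UR.zero))
          (((hb j).mul (hc k)).sub ((hb k).mul (hc j))) UR.one)
  refine key.congr fun s => exists_congr fun x => ?_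
  have := exists_forall_pos_iff (fun j => b j s) fun j => a j s * x + c j s
  rw [show (∃ y, ∀ j, 0 < a j s * x + b j s * y + c j s) ↔
    ∃ y, ∀ j, 0 < b j s * y + (a j s * x + c j s) from
      exists_congr fun y => forall_congr' fun j => by ring_nf, this, Sum.forall, Prod.forall]
  refine and_congr (forall_congr' fun j => ?_) (forall_congr' fun j => forall_congr' fun k => ?_)
  · by_cases h : b j s = 0 <;> simp [h]
  · by_cases h : 0 < b j s <;> by_cases h' : b k s < 0 <;> simp [h, h']
    constructor <;> intro H <;> linarith

end

/-! ## Small nets -/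

/-- The triples that serve as points `(x, y, z)` and as constraints `(a, b, c)`. -/
abbrev Triple : Type := ℝ × ℝ × ℝ

/-- The point `(x, y, z)` satisfies the constraint `a x + b y + c ≤ z`. -/
def Sat (p h : Triple) : Prop := h.1 * p.1 + h.2.1 * p.2.1 + h.2.2 ≤ p.2.2

open Classical in
/-- The members of `N` form a net of the constraints `G`: no point that satisfies them violates
more than one in 200 of all constraints. -/
def IsNet {g : ℕ} (G : Fin g → Triple) (N : Finset (Fin g)) : Prop :=
  ∀ p, (∀ i ∈ N, Sat p (G i)) → 200 * (Finset.univ.filter fun i => ¬ Sat p (G i)).card ≤ g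

/-- Greedy choice: by double counting, some element lies in at least 1/200 of the sets still to be
hit. Each choice therefore leaves at most 199/200 of them, and after `k` choices fewer than one. -/
theorem exists_hitting_set {α : Type*} [Fintype α] [DecidableEq α] (k : ℕ)
    (R : Finset (Finset α)) (hR : ∀ S ∈ R, Fintype.card α < 200 * S.card)
    (hk : R.card * 199 ^ k < 200 ^ k) :
    ∃ N : Finset α, N.card ≤ k ∧ ∀ S ∈ R, ∃ i ∈ S, i ∈ N := by
  induction k generalizing R with
  | zero =>
    refine ⟨∅, by simp, fun S hS => ?_⟩
    have := Finset.card_pos.2 ⟨S, hS⟩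
    omega
  | succ k ih =>
    rcases R.eq_empty_or_nonempty with rfl | ⟨S₀, hS₀⟩
    · exact ⟨∅, by simp, by simp⟩
    have hne : (Finset.univ : Finset α).Nonempty := by
      have := hR S₀ hS₀
      obtain ⟨i, -⟩ := Finset.card_pos.1 (show 0 < S₀.card by omega)
      exact ⟨i, Finset.mem_univ i⟩
    obtain ⟨i, -, hi⟩ : ∃ i ∈ (Finset.univ : Finset α),
        R.card ≤ 200 * (R.filter fun S => i ∈ S).card := by
      refine Finset.exists_le_of_sum_le hne ?_
      have h := Finset.sum_card_bipartiteAbove_eq_sum_card_bipartiteBelow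
        (s := (Finset.univ : Finset α)) (t := R) (fun i S => i ∈ S)
      simp only [Finset.bipartiteAbove, Finset.bipartiteBelow, Finset.filter_mem_eq_inter,
        Finset.univ_inter] at h
      rw [← Finset.mul_sum, h, Finset.mul_sum, Finset.sum_const, Finset.card_univ, smul_eq_mul,
        mul_comm, ← smul_eq_mul, ← Finset.sum_const]
      exact Finset.sum_le_sum fun S hS => (hR S hS).le
    have hc := Finset.card_filter_add_card_filter_not (s := R) (fun S => i ∈ S)
    obtain ⟨N, hN, hN'⟩ := ih (R.filter fun S => ¬ i ∈ S)
      (fun S hS => hR S (Finset.mem_filter.1 hS).1) (by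
        have : 200 * (R.filter fun S => ¬ i ∈ S).card ≤ 199 * R.card := by omega
        have := Nat.mul_le_mul_right (199 ^ k) this
        rw [pow_succ, pow_succ] at hk
        nlinarith)
    refine ⟨insert i N, (Finset.card_insert_le _ _).trans (by omega), fun S hS => ?_⟩
    by_cases hiS : i ∈ S
    · exact ⟨i, hiS, by simp⟩
    · obtain ⟨j, hj, hj'⟩ := hN' S (Finset.mem_filter.2 ⟨hS, hiS⟩)
      exact ⟨j, hj, Finset.mem_insert_of_mem hj'⟩

/-- For a fixed point, satisfaction is an affine inequality in the constraint. So satisfied and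
violated constraints lie in complementary half-spaces, as the Radon argument below requires. -/
theorem convex_setOf_sat (p : Triple) : Convex ℝ {h | Sat p h} := by
  intro h hh k hk s t hs ht hst
  simp only [Set.mem_ofPred_eq, Sat, Prod.fst_add, Prod.snd_add, Prod.smul_fst, Prod.smul_snd,
    smul_eq_mul] at *
  obtain rfl : t = 1 - s := by linarith
  nlinarith [mul_le_mul_of_nonneg_left hh hs, mul_le_mul_of_nonneg_left hk ht]

theorem convex_setOf_not_sat (p : Triple) : Convex ℝ {h | ¬ Sat p h} := by
  intro h hh k hk s t hs ht hst
  simp only [Set.mem_ofPred_eq, Sat, Prod.fst_add, Prod.snd_add, Prod.smul_fst, Prod.smul_snd,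
    smul_eq_mul, not_le] at *
  obtain rfl : t = 1 - s := by linarith
  rcases hs.eq_or_lt with rfl | hs
  · linarith
  · nlinarith [mul_lt_mul_of_pos_left hh hs, mul_le_mul_of_nonneg_left hk.le ht]

open Classical in
/-- The sets of constraints violated by a single point. -/
noncomputable def violationSets {g : ℕ} (G : Fin g → Triple) : Finset (Finset (Fin g)) :=
  Finset.univ.filter fun S => ∃ p, S = Finset.univ.filter fun i => ¬ Sat p (G i)

/-- Five constraints, seen as points of three-space, have a Radon partition. If a point violated
exactly one of its two parts, the common point of the two hulls would be both violated and
satisfied. -/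
theorem card_le_of_shatters {g : ℕ} (G : Fin g → Triple) {S : Finset (Fin g)}
    (hS : (violationSets G).Shatters S) : S.card ≤ 4 := by
  classical
  by_contra! hc
  have hdep : ¬ AffineIndependent ℝ fun i : S => G i := by
    intro h
    have h1 := h.card_le_finrank_succ
    have h2 := Submodule.finrank_le (vectorSpan ℝ (Set.range fun i : S => G i))
    simp only [Fintype.card_coe, Module.finrank_prod, Module.finrank_self] at h1 h2
    omega
  obtain ⟨I, x, hxI, hxc⟩ := Convex.radon_partition hdep
  obtain ⟨U, hU, hUI⟩ := hS (t := S.filter fun i => ∃ h : i ∈ S, (⟨i, h⟩ : S) ∈ I)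
    (Finset.filter_subset _ _)
  simp only [violationSets, Finset.mem_filter, Finset.mem_univ, true_and] at hU
  obtain ⟨p, rfl⟩ := hU
  have key (i : S) : ¬ Sat p (G i) ↔ i ∈ I := by
    have := Finset.ext_iff.1 hUI i
    simpa using this
  have h1 : x ∈ {h | ¬ Sat p h} := convexHull_min (by
    rintro _ ⟨i, hi, rfl⟩
    exact (key i).2 hi) (convex_setOf_not_sat p) hxI
  have h2 : x ∈ {h | Sat p h} := convexHull_min (by
    rintro _ ⟨i, hi, rfl⟩
    exact not_not.1 fun h => hi ((key i).1 h)) (convex_setOf_sat p) hxc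
  exact h1 h2

/-- The Sauer–Shelah bound for VC dimension at most 4, with each of the five binomial coefficients
estimated by `g ^ 4`. -/
theorem card_violationSets_le {g : ℕ} (hg : 0 < g) (G : Fin g → Triple) :
    (violationSets G).card ≤ 5 * g ^ 4 := by
  have hd : (violationSets G).vcDim ≤ 4 :=
    Finset.sup_le fun S hS => card_le_of_shatters G (Finset.mem_shatterer.1 hS)
  calc (violationSets G).card ≤ (violationSets G).shatterer.card :=
        Finset.card_le_card_shatterer _
    _ ≤ ∑ k ∈ Finset.Iic (violationSets G).vcDim, (Fintype.card (Fin g)).choose k :=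
        Finset.card_shatterer_le_sum_vcDim
    _ ≤ ∑ k ∈ Finset.Iic 4, (Fintype.card (Fin g)).choose k :=
        Finset.sum_le_sum_of_subset (Finset.Iic_subset_Iic.2 hd)
    _ ≤ ∑ k ∈ Finset.Iic 4, g ^ 4 := by
        refine Finset.sum_le_sum fun k hk => ?_
        rw [Fintype.card_fin]
        exact (Nat.choose_le_pow g k).trans (Nat.pow_le_pow_right hg (Finset.mem_Iic.1 hk))
    _ = 5 * g ^ 4 := by simp

theorem exists_small_nets : ∃ g : ℕ, 0 < g ∧ ∀ G : Fin g → Triple,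
    ∃ N, IsNet G N ∧ 100 * N.card ≤ g := by
  -- With `g = 100 * k` there are at most `5 * (100 * k) ^ 4` sets to hit. The decay of `(199 / 200)
  -- ^ k` beats this polynomial, so some `k` makes greedy hitting succeed with `k = g / 100`
  -- elements.
  have hlim := (tendsto_pow_const_mul_const_pow_of_lt_one 4 (r := 199 / 200) (by norm_num)
    (by norm_num)).const_mul (5 * 100 ^ 4)
  rw [mul_zero] at hlim
  obtain ⟨k, hk, hk0⟩ := ((hlim.eventually_lt_const one_pos).and
    (Filter.eventually_gt_atTop 0)).exists
  refine ⟨100 * k, by omega, fun G => ?_⟩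
  classical
  obtain ⟨N, hN, hN'⟩ := exists_hitting_set k
    ((violationSets G).filter fun S => 100 * k < 200 * S.card) (by simp) (by
      have h1 := (Finset.card_filter_le (violationSets G) fun S => 100 * k < 200 * S.card).trans
        (card_violationSets_le (by omega) G)
      refine (Nat.mul_le_mul_right _ h1).trans_lt ?_
      rw [div_pow, mul_div_assoc', mul_div_assoc', div_lt_one (by positivity)] at hk
      have : ((5 * (100 * k) ^ 4 * 199 ^ k : ℕ) : ℝ) < ((200 ^ k : ℕ) : ℝ) := by
        push_cast
        calc _ = _ := by ring
          _ < _ := hk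
      exact_mod_cast this)
  refine ⟨N, fun p hp => ?_, by omega⟩
  by_contra! hc
  obtain ⟨i, hi, hiN⟩ := hN' (Finset.univ.filter fun i => ¬ Sat p (G i))
    (Finset.mem_filter.2 ⟨Finset.mem_filter.2 ⟨Finset.mem_univ _, p, rfl⟩, hc⟩)
  exact (Finset.mem_filter.1 hi).2 (hp i hiN)

/-! ### Selecting a net in constant time -/

/-- The encoding of a triple. -/
def encTriple (h : Triple) : Val := .pair (.real h.1) (.pair (.real h.2.1) (.real h.2.2))

/-- The encoding of a list of triples. -/
def encList : List Triple → Val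
  | [] => .nil
  | h :: H => .pair (encTriple h) (encList H)

section
variable {α : Type} {env : α → List Val}

/-- A triple computed in constant time. -/
def UT {α : Type} (env : α → List Val) (f : α → Triple) : Prop := UC env fun a => encTriple (f a)

theorem UT.fst {f : α → Triple} (h : UT env f) : UR env fun a => (f a).1 := UC.fst h
theorem UT.snd_fst {f : α → Triple} (h : UT env f) : UR env fun a => (f a).2.1 :=
  UC.fst (UC.snd h)
theorem UT.snd_snd {f : α → Triple} (h : UT env f) : UR env fun a => (f a).2.2 :=
  UC.snd (UC.snd h)

theorem UC.encList_map {ι : Type} {f : ι → α → Triple} (hf : ∀ i, UT env (f i)) (l : List ι) :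
    UC env fun a => encList (l.map fun i => f i a) := by
  induction l with
  | nil => exact UC.nil
  | cons i l ih => exact (hf i).pair ih

/-- A counterexample satisfies `N` and violates some large `S`. Its `z` can be eliminated at once:
over `(x, y)`, every plane of `S` must lie strictly above every plane of `N`. What remains is a
strict linear system in two variables, which is decidable in constant time. -/
theorem not_isNet_iff {g : ℕ} (G : Fin g → Triple) (N : Finset (Fin g)) :
    ¬ IsNet G N ↔ ∃ S : Finset (Fin g), g < 200 * S.card ∧ ∃ x y, ∀ p : N × S,
      0 < ((G p.2).1 - (G p.1).1) * x + ((G p.2).2.1 - (G p.1).2.1) * y +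
        ((G p.2).2.2 - (G p.1).2.2) := by
  classical
  simp only [IsNet, not_forall, not_le]
  constructor
  · rintro ⟨⟨x, y, z⟩, hp, hc⟩
    refine ⟨_, hc, x, y, fun ⟨⟨i, hi⟩, s, hs⟩ => ?_⟩
    have h1 := hp i hi
    have h2 := (Finset.mem_filter.1 hs).2
    simp only [Sat, not_le] at h1 h2
    linarith
  · rintro ⟨S, hS, x, y, h⟩
    obtain ⟨z, hl, hu⟩ := Finset.exists_between'
      (N.image fun i => (G i).1 * x + (G i).2.1 * y + (G i).2.2)
      (S.image fun i => (G i).1 * x + (G i).2.1 * y + (G i).2.2) (by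
        simp only [Finset.forall_mem_image]
        intro i hi s hs
        linarith [h (⟨i, hi⟩, ⟨s, hs⟩)])
    simp only [Finset.forall_mem_image] at hl hu
    refine ⟨(x, y, z), fun i hi => (hl hi).le, hS.trans_le ?_⟩
    refine Nat.mul_le_mul_left _ (Finset.card_le_card fun s hs => ?_)
    simpa [Sat] using hu hs

theorem UD.isNet {g : ℕ} {G : Fin g → α → Triple} (hG : ∀ i, UT env (G i))
    (N : Finset (Fin g)) : UD env fun a => IsNet (fun i => G i a) N := by
  have key : UD env fun a => ∀ S : Finset (Fin g), ¬ (g < 200 * S.card ∧ ∃ x y, ∀ p : N × S,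
      0 < ((G p.2 a).1 - (G p.1 a).1) * x + ((G p.2 a).2.1 - (G p.1 a).2.1) * y +
        ((G p.2 a).2.2 - (G p.1 a).2.2)) :=
    UD.forall fun S => .not (.and (.const _) (.exists_exists_forall_pos
      (fun p => (hG p.2).fst.sub (hG p.1).fst) (fun p => (hG p.2).snd_fst.sub (hG p.1).snd_fst)
      (fun p => (hG p.2).snd_snd.sub (hG p.1).snd_snd)))
  exact key.congr fun a => not_exists.symm.trans
    ((not_congr (not_isNet_iff (fun i => G i a) N)).symm.trans not_not)

/-- A group of `g` constraints has a constant number of candidate index sets, so a net is found by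
testing them one after another. -/
theorem exists_net_selection : ∃ g : ℕ, 0 < g ∧
    ∀ {α : Type} {env : α → List Val} {G : Fin g → α → Triple}, (∀ i, UT env (G i)) →
      ∃ F, UC env F ∧ ∀ a, ∃ N : Finset (Fin g), IsNet (fun i => G i a) N ∧ 100 * N.card ≤ g ∧
        F a = encList (N.toList.map fun i => G i a) := by
  obtain ⟨g, hg, h⟩ := exists_small_nets
  refine ⟨g, hg, fun {α env G} hG => ?_⟩
  obtain ⟨F, hF, hF'⟩ := UC.select (env := env) (ι := {N : Finset (Fin g) // 100 * N.card ≤ g})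
    (φ := fun N a => IsNet (fun i => G i a) N)
    (f := fun N a => encList (N.1.toList.map fun i => G i a))
    (fun N => UD.isNet hG N) (fun N => UC.encList_map hG _)
  refine ⟨F, hF, fun a => ?_⟩
  obtain ⟨N, hN, hc⟩ := h fun i => G i a
  obtain ⟨M, hM, hM'⟩ := hF' a ⟨⟨N, hc⟩, hN⟩
  exact ⟨M, hM, M.2, hM'⟩

end

/-! ## Lexicographic minima of linear programs -/

/-- The lexicographic order by `z`, then `x`, then `y`. -/
def LexLt (p q : Triple) : Prop :=
  p.2.2 < q.2.2 ∨ p.2.2 = q.2.2 ∧ (p.1 < q.1 ∨ p.1 = q.1 ∧ p.2.1 < q.2.1)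

/-- The lexicographically least point that satisfies all constraints of a list. -/
def IsLexMin (A : List Triple) (p : Triple) : Prop :=
  (∀ h ∈ A, Sat p h) ∧ ∀ q, (∀ h ∈ A, Sat q h) → ¬ LexLt q p

/-- The constraints bound all variables in terms of an upper bound for `z`. -/
def Bounding (Q : List Triple) : Prop :=
  ∀ z₀, Bornology.IsBounded {p : Triple | (∀ h ∈ Q, Sat p h) ∧ p.2.2 ≤ z₀}

theorem lexLt_or_lexLt_of_ne {p q : Triple} (h : p ≠ q) : LexLt p q ∨ LexLt q p := by
  obtain ⟨x, y, z⟩ := p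
  obtain ⟨x', y', z'⟩ := q
  simp only [LexLt, ne_eq, Prod.mk.injEq] at *
  rcases lt_trichotomy z z' with h1 | rfl | h1
  · exact .inl (.inl h1)
  · rcases lt_trichotomy x x' with h2 | rfl | h2
    · exact .inl (.inr ⟨rfl, .inl h2⟩)
    · rcases lt_trichotomy y y' with h3 | rfl | h3
      · exact .inl (.inr ⟨rfl, .inr ⟨rfl, h3⟩⟩)
      · simp at h
      · exact .inr (.inr ⟨rfl, .inr ⟨rfl, h3⟩⟩)
    · exact .inr (.inr ⟨rfl, .inl h2⟩)
  · exact .inr (.inl h1)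

theorem Bounding.append {Q : List Triple} (hQ : Bounding Q) (B : List Triple) :
    Bounding (Q ++ B) := fun z₀ =>
  (hQ z₀).subset fun _ hp => ⟨fun h hh => hp.1 h (List.mem_append_left _ hh), hp.2⟩

theorem isClosed_setOf_sat (A : List Triple) : IsClosed {p : Triple | ∀ h ∈ A, Sat p h} := by
  simp only [Set.ofPred_forall, Sat]
  exact isClosed_iInter fun h => isClosed_iInter fun _ => isClosed_le (by fun_prop) (by fun_prop)

theorem exists_sat (A : List Triple) (x y : ℝ) : ∃ z, ∀ h ∈ A, Sat (x, y, z) h := by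
  induction A with
  | nil => exact ⟨0, by simp⟩
  | cons k A ih =>
    obtain ⟨z, hz⟩ := ih
    refine ⟨max z (k.1 * x + k.2.1 * y + k.2.2), fun h hh => ?_⟩
    rcases List.mem_cons.1 hh with rfl | hh
    · exact le_max_right _ _
    · exact (hz h hh).trans (le_max_left _ _)

/-- Minimize `z`, then `x`, then `y`, each over the compact set of minimizers of the previous stage.
-/
theorem exists_isLexMin {A : List Triple} (hA : Bounding A) : ∃ p, IsLexMin A p := by
  obtain ⟨z₀, hz₀⟩ := exists_sat A 0 0
  have hX : IsCompact {p : Triple | (∀ h ∈ A, Sat p h) ∧ p.2.2 ≤ z₀} :=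
    Metric.isCompact_of_isClosed_isBounded
      ((isClosed_setOf_sat A).inter (isClosed_le (f := fun p : Triple => p.2.2)
        (g := fun _ => z₀) (by fun_prop) (by fun_prop))) (hA z₀)
  set X := {p : Triple | (∀ h ∈ A, Sat p h) ∧ p.2.2 ≤ z₀}
  obtain ⟨p₁, hp₁, hm₁⟩ := hX.exists_isMinOn ⟨(0, 0, z₀), hz₀, le_rfl⟩
    (f := fun p : Triple => p.2.2) (by fun_prop)
  have hX₁ : IsCompact (X ∩ {p | p.2.2 = p₁.2.2}) :=
    hX.inter_right (isClosed_eq (by fun_prop) (by fun_prop))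
  obtain ⟨p₂, hp₂, hm₂⟩ := hX₁.exists_isMinOn ⟨p₁, hp₁, rfl⟩
    (f := fun p : Triple => p.1) (by fun_prop)
  have hX₂ : IsCompact (X ∩ {p | p.2.2 = p₁.2.2} ∩ {p | p.1 = p₂.1}) :=
    hX₁.inter_right (isClosed_eq (by fun_prop) (by fun_prop))
  obtain ⟨p, hp, hm⟩ := hX₂.exists_isMinOn ⟨p₂, hp₂, rfl⟩
    (f := fun p : Triple => p.2.1) (by fun_prop)
  rw [isMinOn_iff] at hm hm₁ hm₂
  obtain ⟨⟨hpX, hpz : p.2.2 = p₁.2.2⟩, hpx : p.1 = p₂.1⟩ := hp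
  refine ⟨p, hpX.1, fun q hq hlt => ?_⟩
  have hqz : q.2.2 ≤ p.2.2 := by
    rcases hlt with h | h
    · exact h.le
    · exact h.1.le
  have hqX : q ∈ X := ⟨hq, hqz.trans hpX.2⟩
  have h1 : q.2.2 = p.2.2 := le_antisymm hqz (by rw [hpz]; exact hm₁ q hqX)
  obtain h | ⟨-, h⟩ := hlt
  · exact h.ne h1
  have h2 := hm₂ q ⟨hqX, h1.trans hpz⟩
  rw [← hpx] at h2
  obtain h | ⟨h3, h⟩ := h
  · exact h2.not_gt h
  · exact (hm q ⟨⟨hqX, h1.trans hpz⟩, h3.trans hpx⟩).not_gt h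

theorem convex_setOf_lexLt (w : Triple) : Convex ℝ {p | LexLt p w} := by
  intro p hp q hq s t hs ht hst
  rcases hs.eq_or_lt with rfl | hs
  · obtain rfl : t = 1 := by linarith
    simpa using hq
  rcases ht.eq_or_lt with rfl | ht
  · obtain rfl : s = 1 := by linarith
    simpa using hp
  have lt_lt {a b c : ℝ} (h1 : a < c) (h2 : b < c) : s * a + t * b < c := by
    have := mul_lt_mul_of_pos_left h1 hs
    have := mul_lt_mul_of_pos_left h2 ht
    have : s * c + t * c = c := by rw [← add_mul, hst, one_mul]
    linarith
  have lt_eq {a b c : ℝ} (h1 : a < c) (h2 : b = c) : s * a + t * b < c := by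
    have := mul_lt_mul_of_pos_left h1 hs
    have : s * c + t * c = c := by rw [← add_mul, hst, one_mul]
    rw [h2]; linarith
  have eq_lt {a b c : ℝ} (h1 : a = c) (h2 : b < c) : s * a + t * b < c := by
    have := mul_lt_mul_of_pos_left h2 ht
    have : s * c + t * c = c := by rw [← add_mul, hst, one_mul]
    rw [h1]; linarith
  have eq_eq {a b c : ℝ} (h1 : a = c) (h2 : b = c) : s * a + t * b = c := by
    rw [h1, h2, ← add_mul, hst, one_mul]
  rcases hp with hp | ⟨hp, hp' | ⟨hp', hp''⟩⟩ <;> rcases hq with hq | ⟨hq, hq' | ⟨hq', hq''⟩⟩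
  · exact .inl (lt_lt hp hq)
  · exact .inl (lt_eq hp hq)
  · exact .inl (lt_eq hp hq)
  · exact .inl (eq_lt hp hq)
  · exact .inr ⟨eq_eq hp hq, .inl (lt_lt hp' hq')⟩
  · exact .inr ⟨eq_eq hp hq, .inl (lt_eq hp' hq')⟩
  · exact .inl (eq_lt hp hq)
  · exact .inr ⟨eq_eq hp hq, .inl (eq_lt hp' hq')⟩
  · exact .inr ⟨eq_eq hp hq, .inr ⟨eq_eq hp' hq', lt_lt hp'' hq''⟩⟩

theorem convex_setOf_sat_of_constraint (h : Triple) : Convex ℝ {p | Sat p h} := by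
  intro p hp q hq s t hs ht hst
  simp only [Set.mem_ofPred_eq, Sat, Prod.fst_add, Prod.snd_add, Prod.smul_fst, Prod.smul_snd,
    smul_eq_mul] at *
  obtain rfl : t = 1 - s := by linarith
  nlinarith [mul_le_mul_of_nonneg_left hp hs, mul_le_mul_of_nonneg_left hq ht]

/-- An optimum is determined, by the Helly theorem, by at most four of the constraints. -/
theorem IsLexMin.exists_basis {A : List Triple} {w : Triple} (hw : IsLexMin A w) :
    ∃ D : Finset Triple, (∀ h ∈ D, h ∈ A) ∧ D.card ≤ 4 ∧
      ∀ p, (∀ h ∈ D, Sat p h) → ¬ LexLt p w := by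
  classical
  by_contra! hc
  -- The empty list is treated apart: an intersection over no constraint would lose the condition
  -- `LexLt p w`.
  rcases A.eq_nil_or_concat with rfl | ⟨A', k, hA⟩
  · obtain ⟨p, hp, hlt⟩ := hc ∅ (by simp) (by simp)
    exact hw.2 p (by simp) hlt
  -- If every four constraints admitted a common point below `w`, Helly's theorem in dimension three
  -- would give a feasible point below `w`.
  have := Convex.helly_theorem' (𝕜 := ℝ) (F := fun h => {p | Sat p h} ∩ {p | LexLt p w})
    (s := A.toFinset) (fun h _ => (convex_setOf_sat_of_constraint h).inter (convex_setOf_lexLt w))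
    (fun D hD hcard => by
      obtain ⟨p, hp, hlt⟩ := hc D (fun h hh => List.mem_toFinset.1 (hD hh))
        (by simpa [Module.finrank_prod] using hcard)
      exact ⟨p, Set.mem_iInter₂.2 fun h hh => ⟨hp h hh, hlt⟩⟩)
  obtain ⟨p, hp⟩ := this
  have hp := Set.mem_iInter₂.1 hp
  refine hw.2 p (fun h hh => (hp h (List.mem_toFinset.2 hh)).1) (hp k ?_).2
  simp [hA]

/-! ### Vertices -/

/-- The common point of the planes of three constraints. -/
noncomputable def planesPoint (i j k : Triple) : Triple :=
  let D := (i.1 - k.1) * (j.2.1 - k.2.1) - (j.1 - k.1) * (i.2.1 - k.2.1)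
  let x := ((j.2.2 - k.2.2) * (i.2.1 - k.2.1) - (i.2.2 - k.2.2) * (j.2.1 - k.2.1)) / D
  let y := ((j.1 - k.1) * (i.2.2 - k.2.2) - (i.1 - k.1) * (j.2.2 - k.2.2)) / D
  (x, y, k.1 * x + k.2.1 * y + k.2.2)

/-- If no three tight constraints have independent planes, some direction `d ≠ 0` keeps all tight
constraints tight. Small moves along `d` and `-d` are then feasible, and one of them is
lexicographically smaller than `p`. -/
theorem IsLexMin.exists_vertex {A : List Triple} {p : Triple} (hp : IsLexMin A p) :
    ∃ i ∈ A, ∃ j ∈ A, ∃ k ∈ A, p = planesPoint i j k := by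
  by_contra! hc
  let tight : Triple → Prop := fun h => h.1 * p.1 + h.2.1 * p.2.1 + h.2.2 = p.2.2
  have hdet : ∀ i ∈ A, ∀ j ∈ A, ∀ k ∈ A, tight i → tight j → tight k →
      (i.1 - k.1) * (j.2.1 - k.2.1) - (j.1 - k.1) * (i.2.1 - k.2.1) = 0 := by
    intro i hi j hj k hk ti tj tk
    by_contra hD
    refine hc i hi j hj k hk ?_
    have hx : p.1 = (planesPoint i j k).1 := by
      simp only [planesPoint]
      rw [eq_div_iff hD]
      linear_combination (j.2.1 - k.2.1) * (ti - tk) - (i.2.1 - k.2.1) * (tj - tk)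
    have hy : p.2.1 = (planesPoint i j k).2.1 := by
      simp only [planesPoint]
      rw [eq_div_iff hD]
      linear_combination (i.1 - k.1) * (tj - tk) - (j.1 - k.1) * (ti - tk)
    have hz : p.2.2 = k.1 * (planesPoint i j k).1 + k.2.1 * (planesPoint i j k).2.1 + k.2.2 := by
      rw [← hx, ← hy]
      exact tk.symm
    exact Prod.ext hx (Prod.ext hy hz)
  -- The direction is parallel to the intersection of two crossing tight planes, or lies in the
  -- single tight plane, or is vertical if nothing is tight.
  obtain ⟨d, hd, hdt⟩ : ∃ d : Triple, d ≠ 0 ∧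
      ∀ h ∈ A, tight h → h.1 * d.1 + h.2.1 * d.2.1 = d.2.2 := by
    by_cases h0 : ∃ k ∈ A, tight k
    · obtain ⟨k, hk, tk⟩ := h0
      by_cases h1 : ∃ j ∈ A, tight j ∧ (j.1 - k.1 ≠ 0 ∨ j.2.1 - k.2.1 ≠ 0)
      · obtain ⟨j, hj, tj, hjk⟩ := h1
        refine ⟨(j.2.1 - k.2.1, -(j.1 - k.1), k.1 * (j.2.1 - k.2.1) + k.2.1 * -(j.1 - k.1)),
          fun h => ?_, fun i hi ti => ?_⟩
        · simp only [Prod.ext_iff, Prod.fst_zero, Prod.snd_zero, neg_eq_zero] at h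
          rcases hjk with hjk | hjk
          · exact hjk h.2.1
          · exact hjk h.1
        · linear_combination hdet i hi j hj k hk ti tj tk
      · push Not at h1
        refine ⟨(1, 0, k.1), by simp, fun i hi ti => ?_⟩
        linear_combination (h1 i hi ti).1
    · push Not at h0
      exact ⟨(0, 0, 1), by simp, fun h hh ht => absurd ht (h0 h hh)⟩
  have hev : ∀ᶠ ε in nhds (0 : ℝ), ∀ h ∈ A, Sat (p + ε • d) h := by
    have := (Filter.eventually_all_finite (l := nhds (0 : ℝ)) (List.finite_toSet A)
      (p := fun h ε => Sat (p + ε • d) h)).2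
    refine this fun h hh => ?_
    simp only [Sat, Prod.fst_add, Prod.snd_add, Prod.smul_fst, Prod.smul_snd, smul_eq_mul]
    rcases (hp.1 h hh).eq_or_lt with ht | ht
    · refine Filter.Eventually.of_forall fun ε => le_of_eq ?_
      linear_combination ht + ε * hdt h hh ht
    · have h1 : Filter.Tendsto (fun ε => h.1 * (p.1 + ε * d.1) + h.2.1 * (p.2.1 + ε * d.2.1) +
          h.2.2) (nhds 0) (nhds (h.1 * (p.1 + 0 * d.1) + h.2.1 * (p.2.1 + 0 * d.2.1) + h.2.2)) :=
        Continuous.tendsto (by fun_prop) 0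
      have h2 : Filter.Tendsto (fun ε => p.2.2 + ε * d.2.2) (nhds 0)
          (nhds (p.2.2 + 0 * d.2.2)) := Continuous.tendsto (by fun_prop) 0
      exact (h1.eventually_lt h2 (by simpa using ht)).mono fun _ => le_of_lt
  obtain ⟨r, hr, hball⟩ := Metric.eventually_nhds_iff.1 hev
  have hpos := hball (y := r / 2) (by rw [Real.dist_eq, sub_zero, abs_of_pos] <;> linarith)
  have hneg := hball (y := -(r / 2)) (by
    rw [Real.dist_eq, sub_zero, abs_neg, abs_of_pos] <;> linarith)
  have hr2 : 0 < r / 2 := by linarith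
  have hmul (x : ℝ) : r / 2 * x < 0 ↔ x < 0 :=
    ⟨fun h => lt_of_not_ge fun hx => (mul_nonneg hr2.le hx).not_gt h,
      mul_neg_of_pos_of_neg hr2⟩
  have h1 := hp.2 _ hpos
  have h2 := hp.2 _ hneg
  simp only [LexLt, Prod.fst_add, Prod.snd_add, Prod.smul_fst, Prod.smul_snd, smul_eq_mul,
    add_lt_iff_neg_left, add_eq_left, mul_eq_zero, hr2.ne', false_or, neg_eq_zero, neg_mul,
    Left.neg_neg_iff, not_or, not_and, mul_pos_iff_of_pos_left hr2,
    hmul] at h1 h2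
  have e1 : d.2.2 = 0 := le_antisymm (not_lt.1 h2.1) (not_lt.1 h1.1)
  have e2 : d.1 = 0 := le_antisymm (not_lt.1 (h2.2 e1).1) (not_lt.1 (h1.2 e1).1)
  have e3 : d.2.1 = 0 :=
    le_antisymm (not_lt.1 ((h2.2 e1).2 e2)) (not_lt.1 ((h1.2 e1).2 e2))
  exact hd (Prod.ext e2 (Prod.ext e3 e1))

/-! ### Brute force in constant time -/

section
variable {α : Type} {env : α → List Val}

theorem UD.sat {p h : α → Triple} (hp : UT env p) (hh : UT env h) :
    UD env fun a => Sat (p a) (h a) :=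
  UD.le (((hh.fst.mul hp.fst).add (hh.snd_fst.mul hp.snd_fst)).add hh.snd_snd) hp.snd_snd

theorem UD.lexLt {p q : α → Triple} (hp : UT env p) (hq : UT env q) :
    UD env fun a => LexLt (p a) (q a) :=
  .or (.lt hp.snd_snd hq.snd_snd) (.and (.eq hp.snd_snd hq.snd_snd)
    (.or (.lt hp.fst hq.fst) (.and (.eq hp.fst hq.fst) (.lt hp.snd_fst hq.snd_fst))))

theorem UT.planesPoint {i j k : α → Triple} (hi : UT env i) (hj : UT env j) (hk : UT env k) :
    UT env fun a => planesPoint (i a) (j a) (k a) := by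
  have ha := hi.fst.sub hk.fst
  have hb := hi.snd_fst.sub hk.snd_fst
  have hc := hi.snd_snd.sub hk.snd_snd
  have ha' := hj.fst.sub hk.fst
  have hb' := hj.snd_fst.sub hk.snd_fst
  have hc' := hj.snd_snd.sub hk.snd_snd
  have hD := (ha.mul hb').sub (ha'.mul hb)
  have hx := ((hc'.mul hb).sub (hc.mul hb')).div hD
  have hy := ((ha'.mul hc).sub (ha.mul hc')).div hD
  exact UC.pair hx (UC.pair hy (((hk.fst.mul hx).add (hk.snd_fst.mul hy)).add hk.snd_snd))

/-- Among the points `planesPoint` of all triples, a feasible one is taken that no other feasible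
one precedes. Degenerate triples yield arbitrary points, but these are harmless: the optimum is
among the candidates and precedes every other feasible point. -/
theorem exists_lexMin_selection {ι : Type} [Finite ι] {A : ι → α → Triple}
    (hA : ∀ i, UT env (A i)) : ∃ F, UC env F ∧ ∀ (a : α) (l : List Triple),
      (∀ h, h ∈ l ↔ ∃ i, A i a = h) → ∀ p, IsLexMin l p → F a = encTriple p := by
  have hv (t : ι × ι × ι) := UT.planesPoint (hA t.1) (hA t.2.1) (hA t.2.2)
  have hfeas (t : ι × ι × ι) := UD.forall fun h => UD.sat (hv t) (hA h)
  obtain ⟨F, hF, hF'⟩ := UC.select (fun t : ι × ι × ι => (hfeas t).and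
    (UD.forall fun t' => (hfeas t').imp (UD.lexLt (hv t') (hv t)).not)) hv
  refine ⟨F, hF, fun a l hl p hp => ?_⟩
  have hfeas (q : Triple) : (∀ h, Sat q (A h a)) ↔ ∀ h ∈ l, Sat q h := by
    simp only [hl]
    exact ⟨fun h k ⟨i, hi⟩ => hi ▸ h i, fun h i => h _ ⟨i, rfl⟩⟩
  obtain ⟨t₀, ht₀⟩ : ∃ t : ι × ι × ι, p = planesPoint (A t.1 a) (A t.2.1 a) (A t.2.2 a) := by
    obtain ⟨i, hi, j, hj, k, hk, h⟩ := hp.exists_vertex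
    obtain ⟨i, rfl⟩ := (hl i).1 hi
    obtain ⟨j, rfl⟩ := (hl j).1 hj
    obtain ⟨k, rfl⟩ := (hl k).1 hk
    exact ⟨(i, j, k), h⟩
  obtain ⟨t, ⟨h1, h2⟩, h3⟩ := hF' a ⟨t₀, by
    rw [← ht₀, hfeas]
    exact ⟨hp.1, fun t' ht' => hp.2 _ ((hfeas _).1 ht')⟩⟩
  rw [h3]
  congr 1
  by_contra hne
  rcases lexLt_or_lexLt_of_ne hne with h | h
  · exact hp.2 _ ((hfeas _).1 h1) h
  · exact h2 t₀ (by rw [← ht₀, hfeas]; exact hp.1) (ht₀ ▸ h)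

end

/-! ### The Clarkson iteration -/

open Classical in
/-- The lexicographic minimum, if it exists. -/
noncomputable def lexMin (A : List Triple) : Triple :=
  if h : ∃ p, IsLexMin A p then h.choose else 0

theorem Bounding.isLexMin {A : List Triple} (hA : Bounding A) : IsLexMin A (lexMin A) := by
  rw [lexMin, dif_pos (exists_isLexMin hA)]
  exact (exists_isLexMin hA).choose_spec

open Classical in
/-- The constraints violated by a point. -/
noncomputable def violators (p : Triple) (H : List Triple) : List Triple :=
  H.filter fun h => ¬ Sat p h

/-- One round: to `B` are added the constraints violated by the optimum of `Q` and `B`. -/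
noncomputable def augment (Q H B : List Triple) : List Triple :=
  violators (lexMin (Q ++ B)) H ++ B

theorem mem_violators {p h : Triple} {H : List Triple} :
    h ∈ violators p H ↔ h ∈ H ∧ ¬ Sat p h := by simp [violators]

theorem subset_augment_iterate {Q H N : List Triple} (k : ℕ) :
    N ⊆ (augment Q H)^[k] N := by
  induction k with
  | zero => simp
  | succ k ih =>
    rw [Function.iterate_succ_apply']
    exact fun h hh => List.mem_append_right _ (ih hh)

theorem augment_iterate_subset {Q H N : List Triple} (hN : N ⊆ H) (k : ℕ) :
    (augment Q H)^[k] N ⊆ H := by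
  induction k with
  | zero => simpa
  | succ k ih =>
    rw [Function.iterate_succ_apply']
    intro h hh
    rcases List.mem_append.1 hh with hh | hh
    · exact (mem_violators.1 hh).1
    · exact ih hh

/-- The potential is the number of members of a basis `D` still missing from `Q ++ B`. If the
optimum of `Q ++ B` is not `w`, it violates a member of `D`, which is thus missing, and the round
adds it. Starting from at most four, the potential vanishes after four rounds. -/
theorem lexMin_augment_iterate {Q H N : List Triple} (hQ : Bounding Q) (hN : N ⊆ H) :
    lexMin (Q ++ (augment Q H)^[4] N) = lexMin (Q ++ H) := by
  classical
  have hw := (hQ.append H).isLexMin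
  set w := lexMin (Q ++ H) with hw_def
  obtain ⟨D, hDH, hD4, hD⟩ := hw.exists_basis
  -- A point satisfying `D` is not below `w`; the optimum for fewer constraints is not above `w`.
  have hbasis : ∀ B ⊆ H, (∀ h ∈ D, Sat (lexMin (Q ++ B)) h) → lexMin (Q ++ B) = w := by
    intro B hB h
    have hp := (hQ.append B).isLexMin
    by_contra hne
    rcases lexLt_or_lexLt_of_ne hne with hlt | hlt
    · exact hD _ h hlt
    · exact hp.2 _ (fun h hh => hw.1 h
        (List.mem_append.2 ((List.mem_append.1 hh).imp_right (@hB h)))) hlt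
  have key : ∀ k ≤ 4, lexMin (Q ++ (augment Q H)^[k] N) = w ∨
      (D.filter fun h => h ∉ Q ++ (augment Q H)^[k] N).card + k ≤ 4 := by
    intro k
    induction k with
    | zero => exact fun _ => .inr ((Finset.card_filter_le _ _).trans hD4)
    | succ k ih =>
      intro hk
      rw [Function.iterate_succ_apply']
      have hB := augment_iterate_subset (Q := Q) hN k
      set B := (augment Q H)^[k] N
      by_cases hopt : lexMin (Q ++ B) = w
      · left
        have : violators (lexMin (Q ++ B)) H = [] := by
          rw [hopt, violators, List.filter_eq_nil_iff]
          intro h hh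
          simpa using hw.1 h (List.mem_append_right _ hh)
        rw [augment, this, List.nil_append, hopt]
      · right
        have hcard := (ih (by omega)).resolve_left hopt
        obtain ⟨h, hhD, hh⟩ : ∃ h ∈ D, ¬ Sat (lexMin (Q ++ B)) h := by
          by_contra! hc
          exact hopt (hbasis B hB hc)
        have hmem : h ∉ Q ++ B := fun hm => hh ((hQ.append B).isLexMin.1 h hm)
        have hH : h ∈ H := by
          rcases List.mem_append.1 (hDH h hhD) with h' | h'
          · exact absurd (List.mem_append_left _ h') hmem
          · exact h'
        have hlt : (D.filter fun h => h ∉ Q ++ augment Q H B).card <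
            (D.filter fun h => h ∉ Q ++ B).card := by
          refine Finset.card_lt_card ((Finset.ssubset_iff_of_subset fun k hk => ?_).2
            ⟨h, Finset.mem_filter.2 ⟨hhD, hmem⟩, fun hm => ?_⟩)
          · refine Finset.mem_filter.2 ⟨(Finset.mem_filter.1 hk).1, fun hm => ?_⟩
            refine (Finset.mem_filter.1 hk).2 ?_
            simp only [augment, List.mem_append] at hm ⊢
            tauto
          · refine (Finset.mem_filter.1 hm).2 (List.mem_append_right _
              (List.mem_append_left _ (mem_violators.2 ⟨hH, hh⟩)))
        omega
  rcases key 4 le_rfl with h | h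
  · exact h
  · refine hbasis _ (augment_iterate_subset hN 4) fun h' hh' => ?_
    have : (D.filter fun h => h ∉ Q ++ (augment Q H)^[4] N) = ∅ :=
      Finset.card_eq_zero.1 (by omega)
    have := Finset.filter_eq_empty_iff.1 this hh'
    exact (hQ.append _).isLexMin.1 _ (not_not.1 this)

/-! ## Access to lists -/

/-- `k` times the second component. -/
def dropExpr (e : Expr) : ℕ → Expr
  | 0 => e
  | k + 1 => .snd (dropExpr e k)

theorem EvalLe.dropExpr {P : Program} {env : List Val} {e : Expr} {H : List Triple} {T : ℕ}
    (h : EvalLe P env e (encList H) T) : ∀ {k : ℕ}, k ≤ H.length →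
      EvalLe P env (dropExpr e k) (encList (H.drop k)) (T + k)
  | 0, _ => h
  | k + 1, hk => by
    have ih := h.dropExpr (k := k) (by omega)
    rw [List.drop_eq_getElem_cons (by omega)] at ih
    exact ih.snd

theorem UT.getD {α : Type} {env : α → List Val} {H : α → List Triple}
    (h : UC env fun a => encList (H a)) {i : ℕ} (hi : ∀ a, i < (H a).length) :
    UT env fun a => (H a).getD i 0 := by
  obtain ⟨e, T, h⟩ := h
  refine ⟨.fst (LineTour.dropExpr e i), T + i + 1, fun P a => ?_⟩
  have := (h P a).dropExpr (hi a).le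
  rw [List.drop_eq_getElem_cons (hi a)] at this
  simpa only [List.getD_eq_getElem _ _ (hi a)] using this.fst

/-- Case distinction by the length of a list: one branch for each length less than `m`, and one
for all others. -/
def lenSwitch (bs : ℕ → Expr) (other : Expr) : ℕ → ℕ → Expr → Expr
  | 0, _, _ => other
  | m + 1, k, e => .ifNil e (bs k) (lenSwitch bs other m (k + 1) (.snd e))

/-- The expression `e` is evaluated again at each test, with one more `snd`; hence the bound
quadratic in `m`. -/
theorem EvalLe.lenSwitch_lt {P : Program} {env : List Val} {bs : ℕ → Expr} {other : Expr}
    {v : Val} {T' : ℕ} : ∀ {m k : ℕ} {e : Expr} {H : List Triple} {T : ℕ},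
      EvalLe P env e (encList H) T → H.length < m → EvalLe P env (bs (k + H.length)) v T' →
        EvalLe P env (lenSwitch bs other m k e) v (T' + m * (T + m + 1))
  | m + 1, k, e, [], T, h, _, hb => (EvalLe.ifNil_nil h hb).mono (by ring_nf; omega)
  | m + 1, k, e, a :: H, T, h, hm, hb => by
    have hb' : EvalLe P env (bs (k + 1 + H.length)) v T' := by
      rwa [List.length_cons, add_comm H.length, ← add_assoc] at hb
    have ih := EvalLe.lenSwitch_lt (other := other) h.snd
      (by simpa using hm : H.length < m) hb'
    exact (EvalLe.ifNil_pair h ih).mono (by ring_nf; omega)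

theorem EvalLe.lenSwitch_ge {P : Program} {env : List Val} {bs : ℕ → Expr} {other : Expr}
    {v : Val} {T' : ℕ} (hb : EvalLe P env other v T') :
    ∀ {m k : ℕ} {e : Expr} {H : List Triple} {T : ℕ},
      EvalLe P env e (encList H) T → m ≤ H.length →
        EvalLe P env (lenSwitch bs other m k e) v (T' + m * (T + m + 1))
  | 0, _, _, _, _, _, _ => hb.mono (by omega)
  | m + 1, k, e, a :: H, T, h, hm => by
    have ih := hb.lenSwitch_ge (bs := bs) (k := k + 1) h.snd (by simpa using hm : m ≤ H.length)
    exact (EvalLe.ifNil_pair h ih).mono (by ring_nf; omega)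

/-! ## The program -/

/-- The normalized constraints `±(a x + b y + c) / √(a² + b²) ≤ z` of a list of lines. -/
noncomputable def doubled : List Triple → List Triple
  | [] => []
  | h :: H =>
    let s := √(h.1 * h.1 + h.2.1 * h.2.1)
    (h.1 / s, h.2.1 / s, h.2.2 / s) ::
      ((0 - h.1) / s, (0 - h.2.1) / s, (0 - h.2.2) / s) :: doubled H

open Classical in
/-- A line of a list that is not parallel to `l`, or a line perpendicular to `l` if there is
none. -/
noncomputable def transversal (l : Triple) : List Triple → Triple
  | [] => (0 - l.2.1, l.1, 0)
  | h :: H => if l.1 * h.2.1 - l.2.1 * h.1 = 0 then transversal l H else h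

/-- Entry point: the argument is the list of lines. -/
def mainBody : Expr :=
  .call 3 (.pair
    (.call 1 (.pair (.fst (.var 0)) (.pair (.call 2 (.pair (.fst (.var 0)) (.var 0))) .nil)))
    (.call 1 (.var 0)))

/-- Function 1 computes `doubled`. -/
def doubledBody : Expr :=
  .ifNil (.var 0) .nil <|
  .letIn (.fst (.var 0)) <|
  .letIn (.sqrt (.add (.mul (.fst (.var 0)) (.fst (.var 0)))
    (.mul (.fst (.snd (.var 0))) (.fst (.snd (.var 0)))))) <|
  .pair (.pair (.div (.fst (.var 1)) (.var 0)) (.pair (.div (.fst (.snd (.var 1))) (.var 0))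
    (.div (.snd (.snd (.var 1))) (.var 0)))) <|
  .pair (.pair (.div (.sub (.num 0) (.fst (.var 1))) (.var 0))
    (.pair (.div (.sub (.num 0) (.fst (.snd (.var 1)))) (.var 0))
      (.div (.sub (.num 0) (.snd (.snd (.var 1)))) (.var 0))))
  (.call 1 (.snd (.var 2)))

/-- Function 2 computes `transversal`. -/
def transversalBody : Expr :=
  .letIn (.fst (.var 0)) <|
  .ifNil (.snd (.var 1))
    (.pair (.sub (.num 0) (.fst (.snd (.var 0)))) (.pair (.fst (.var 0)) (.num 0))) <|
  .letIn (.fst (.snd (.var 1))) <|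
  .letIn (.sub (.mul (.fst (.var 1)) (.fst (.snd (.var 0))))
    (.mul (.fst (.snd (.var 1))) (.fst (.var 0)))) <|
  .ifLe (.var 0) (.num 0)
    (.ifLe (.num 0) (.var 0) (.call 2 (.pair (.var 2) (.snd (.snd (.var 3))))) (.var 1))
    (.var 1)

/-- One round of the iteration, applied to the list computed by `e`. -/
def roundExpr (e : Expr) : Expr := .call 4 (.pair (.fst (.var 0)) (.pair (.snd (.var 0)) e))

/-- Function 3 computes the lexicographic minimum of `Q ++ H`. -/
def lexMinBody (base : ℕ → Expr) (m : ℕ) : Expr :=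
  lenSwitch base (.call 3 (.pair (.fst (.var 0))
    (roundExpr (roundExpr (roundExpr (roundExpr (.call 5 (.snd (.var 0)))))))))
    m 0 (.snd (.var 0))

/-- Function 4 computes `augment Q H B`. -/
def augmentBody : Expr :=
  .letIn (.snd (.snd (.var 0))) <|
  .call 7 (.pair
    (.call 6 (.pair (.call 3 (.pair (.fst (.var 1)) (.var 0))) (.fst (.snd (.var 1)))))
    (.var 0))

/-- Function 5 computes a union of nets of groups. -/
def netsBody (net : Expr) (g : ℕ) : Expr :=
  lenSwitch (fun _ => .var 0) (.call 7 (.pair net (.call 5 (dropExpr (.var 0) g)))) g 0 (.var 0)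

/-- Function 6 computes `violators p H`. -/
def violatorsBody : Expr :=
  .ifNil (.snd (.var 0)) .nil <|
  .letIn (.fst (.snd (.var 0))) <|
  .letIn (.fst (.var 1)) <|
  .letIn (.call 6 (.pair (.var 0) (.snd (.snd (.var 2))))) <|
  .ifLe (.add (.add (.mul (.fst (.var 2)) (.fst (.var 1)))
      (.mul (.fst (.snd (.var 2))) (.fst (.snd (.var 1))))) (.snd (.snd (.var 2))))
    (.snd (.snd (.var 1))) (.var 0) (.pair (.var 2) (.var 0))

/-- Function 7 appends two lists. -/
def appendBody : Expr :=
  .ifNil (.fst (.var 0)) (.snd (.var 0))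
    (.pair (.fst (.fst (.var 0))) (.call 7 (.pair (.snd (.fst (.var 0))) (.snd (.var 0)))))

/-- The program, up to the expressions for the problems of bounded size. -/
def program (base : ℕ → Expr) (m : ℕ) (net : Expr) (g : ℕ) : Program :=
  [mainBody, doubledBody, transversalBody, lexMinBody base m, augmentBody, netsBody net g,
    violatorsBody, appendBody]

section
variable {base : ℕ → Expr} {m : ℕ} {net : Expr} {g : ℕ}

theorem evalLe_zero {P : Program} {env : List Val} : EvalLe P env (.num 0) (.real 0) 1 := by
  simpa using EvalLe.num (P := P) (env := env) (q := 0)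

theorem evalLe_append (B : List Triple) : ∀ A : List Triple,
    EvalLe (program base m net g) [.pair (encList A) (encList B)] appendBody (encList (A ++ B))
      (20 * (A.length + 1))
  | [] => (EvalLe.ifNil_nil (.fst (.var rfl)) (.snd (.var rfl))).mono (by simp)
  | h :: A => (EvalLe.ifNil_pair (.fst (.var rfl)) (.pair (.fst (.fst (.var rfl)))
      (.call (.pair (.snd (.fst (.var rfl))) (.snd (.var rfl))) rfl (evalLe_append B A)))).mono
      (by simp only [List.length_cons]; omega)

theorem evalLe_violators (p : Triple) : ∀ H : List Triple,
    EvalLe (program base m net g) [.pair (encTriple p) (encList H)] violatorsBody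
      (encList (violators p H))
      (60 * (H.length + 1))
  | [] => (EvalLe.ifNil_nil (.snd (.var rfl)) .nil).mono (by simp)
  | h :: H => by
    by_cases hs : Sat p h
    · rw [violators, List.filter_cons_of_neg (by simpa using hs)]
      exact (EvalLe.ifNil_pair (.snd (.var rfl)) (.letIn (.fst (.snd (.var rfl)))
        (.letIn (.fst (.var rfl)) (.letIn (.call (.pair (.var rfl) (.snd (.snd (.var rfl)))) rfl
          (evalLe_violators p H))
          (.ifLe_true (.add (.add (.mul (.fst (.var rfl)) (.fst (.var rfl)))
            (.mul (.fst (.snd (.var rfl))) (.fst (.snd (.var rfl))))) (.snd (.snd (.var rfl))))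
            (.snd (.snd (.var rfl))) hs (.var rfl)))))).mono
          (by simp only [List.length_cons]; omega)
    · rw [violators, List.filter_cons_of_pos (by simpa using hs)]
      exact (EvalLe.ifNil_pair (.snd (.var rfl)) (.letIn (.fst (.snd (.var rfl)))
        (.letIn (.fst (.var rfl)) (.letIn (.call (.pair (.var rfl) (.snd (.snd (.var rfl)))) rfl
          (evalLe_violators p H))
          (.ifLe_false (.add (.add (.mul (.fst (.var rfl)) (.fst (.var rfl)))
            (.mul (.fst (.snd (.var rfl))) (.fst (.snd (.var rfl))))) (.snd (.snd (.var rfl))))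
            (.snd (.snd (.var rfl))) (not_le.1 hs) (.pair (.var rfl) (.var rfl))))))).mono
          (by simp only [List.length_cons]; omega)

theorem evalLe_doubled : ∀ L : List Triple, (∀ l ∈ L, l.1 ≠ 0 ∨ l.2.1 ≠ 0) →
    EvalLe (program base m net g) [encList L] doubledBody (encList (doubled L)) (80 * (L.length + 1))
  | [], _ => (EvalLe.ifNil_nil (.var rfl) .nil).mono (by simp)
  | h :: L, hL => by
    have hpos : 0 < h.1 * h.1 + h.2.1 * h.2.1 := by
      rcases hL h (by simp) with h' | h'
      · have := mul_self_pos.2 h'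
        have := mul_self_nonneg h.2.1
        linarith
      · have := mul_self_pos.2 h'
        have := mul_self_nonneg h.1
        linarith
    have hs := (Real.sqrt_pos.2 hpos).ne'
    exact (EvalLe.ifNil_pair (.var rfl) (.letIn (.fst (.var rfl))
      (.letIn (.sqrt (.add (.mul (.fst (.var rfl)) (.fst (.var rfl)))
        (.mul (.fst (.snd (.var rfl))) (.fst (.snd (.var rfl))))) hpos.le)
      (.pair (.pair (.div (.fst (.var rfl)) (.var rfl) hs)
        (.pair (.div (.fst (.snd (.var rfl))) (.var rfl) hs)
          (.div (.snd (.snd (.var rfl))) (.var rfl) hs)))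
      (.pair (.pair (.div (.sub evalLe_zero (.fst (.var rfl))) (.var rfl) hs)
        (.pair (.div (.sub evalLe_zero (.fst (.snd (.var rfl)))) (.var rfl) hs)
          (.div (.sub evalLe_zero (.snd (.snd (.var rfl)))) (.var rfl) hs)))
      (.call (.snd (.var rfl)) rfl
        (evalLe_doubled L fun l hl => hL l (List.mem_cons_of_mem _ hl)))))))).mono
      (by simp only [List.length_cons]; omega)

theorem evalLe_transversal (l : Triple) : ∀ L : List Triple,
    EvalLe (program base m net g) [.pair (encTriple l) (encList L)] transversalBody
      (encTriple (transversal l L))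
      (60 * (L.length + 1))
  | [] => (EvalLe.letIn (.fst (.var rfl)) (.ifNil_nil (.snd (.var rfl))
      (.pair (.sub evalLe_zero (.fst (.snd (.var rfl)))) (.pair (.fst (.var rfl))
        evalLe_zero)))).mono (by simp)
  | h :: L => by
    have hsub : EvalLe (program base m net g)
        [encTriple h, encTriple l, .pair (encTriple l) (encList (h :: L))]
        (.sub (.mul (.fst (.var 1)) (.fst (.snd (.var 0))))
          (.mul (.fst (.snd (.var 1))) (.fst (.var 0))))
        (.real (l.1 * h.2.1 - l.2.1 * h.1)) _ :=
      .sub (.mul (.fst (.var rfl)) (.fst (.snd (.var rfl))))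
        (.mul (.fst (.snd (.var rfl))) (.fst (.var rfl)))
    rcases lt_trichotomy (l.1 * h.2.1 - l.2.1 * h.1) 0 with hD | hD | hD
    · rw [transversal, if_neg hD.ne]
      exact (EvalLe.letIn (.fst (.var rfl)) (.ifNil_pair (.snd (.var rfl))
        (.letIn (.fst (.snd (.var rfl))) (.letIn hsub
          (.ifLe_true (.var rfl) evalLe_zero hD.le (.ifLe_false evalLe_zero (.var rfl) hD
            (.var rfl))))))).mono (by simp only [List.length_cons]; omega)
    · rw [transversal, if_pos hD]
      exact (EvalLe.letIn (.fst (.var rfl)) (.ifNil_pair (.snd (.var rfl))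
        (.letIn (.fst (.snd (.var rfl))) (.letIn hsub
          (.ifLe_true (.var rfl) evalLe_zero hD.le (.ifLe_true evalLe_zero (.var rfl) hD.ge
            (.call (.pair (.var rfl) (.snd (.snd (.var rfl)))) rfl
              (evalLe_transversal l L)))))))).mono (by simp only [List.length_cons]; omega)
    · rw [transversal, if_neg hD.ne']
      exact (EvalLe.letIn (.fst (.var rfl)) (.ifNil_pair (.snd (.var rfl))
        (.letIn (.fst (.snd (.var rfl))) (.letIn hsub
          (.ifLe_false (.var rfl) evalLe_zero hD (.var rfl)))))).mono
          (by simp only [List.length_cons]; omega)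

end

/-! ## Running time -/

theorem length_violators_ofFn {g : ℕ} (p : Triple) (G : Fin g → Triple) [DecidablePred (Sat p)] :
    (violators p (List.ofFn G)).length =
      (Finset.univ.filter fun i => ¬ Sat p (G i)).card := by
  classical
  rw [violators, List.ofFn_eq_map, List.filter_map, List.length_map,
    ← List.toFinset_card_of_nodup ((List.nodup_finRange g).filter _)]
  congr 1
  ext i
  simp

/-- The net of the first `g` constraints is joined to the result for the rest; violations add up
over the groups. A remainder shorter than `g` is kept whole, which accounts for the summand `100 *
g`. -/
theorem exists_netsBody : ∃ (net : Expr) (g K : ℕ), ∀ (base : ℕ → Expr) (m : ℕ)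
    (H : List Triple), ∃ N,
      EvalLe (program base m net g) [encList H] (netsBody net g) (encList N)
        (K * (H.length + 1)) ∧
      N ⊆ H ∧ 100 * N.length ≤ H.length + 100 * g ∧
      ∀ p, (∀ h ∈ N, Sat p h) → 200 * (violators p H).length ≤ H.length := by
  classical
  obtain ⟨g, hg, hsel⟩ := exists_net_selection
  -- Restricting to lists of length at least `g` ensures that the entries read exist, so that the
  -- default of `getD` never matters.
  obtain ⟨F, ⟨net, T, hnet⟩, hF⟩ := hsel (α := {H : List Triple // g ≤ H.length})
    (env := fun H => [encList H.1]) (G := fun i H => H.1.getD i 0)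
    (fun i => UT.getD ⟨.var 0, 1, fun _ _ => .var rfl⟩ fun H => i.2.trans_le H.2)
  refine ⟨net, g, T + 20 * (g + 1) + g + 20 + g * (g + 2), fun base m H => ?_⟩
  set K := T + 20 * (g + 1) + g + 20 + g * (g + 2) with hK
  induction hn : H.length using Nat.strong_induction_on generalizing H with
  | _ n ih =>
  subst hn
  by_cases hlen : H.length < g
  · refine ⟨H, (EvalLe.lenSwitch_lt (bs := fun _ => .var 0) (.var rfl) hlen (.var rfl)).mono ?_,
      fun h hh => hh, by omega, fun p hp => ?_⟩
    · nlinarith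
    · have : violators p H = [] := by
        rw [violators, List.filter_eq_nil_iff]
        intro h hh
        simpa using hp h hh
      simp [this]
  rw [not_lt] at hlen
  obtain ⟨M, hM, hMc, hFM⟩ := hF ⟨H, hlen⟩
  set A := M.toList.map fun i : Fin g => H.getD i 0 with hA
  have hAlen : A.length = M.card := by simp [hA]
  have htake : H.take g = List.ofFn fun i : Fin g => H.getD i 0 := by
    refine List.ext_getElem (by simp [hlen]) fun i h1 h2 => ?_
    have : i < H.length := by simp at h1; omega
    simp [List.getElem?_eq_getElem this]
  have hd : (H.drop g).length < H.length := by simp; omega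
  obtain ⟨N, hN, hsub, hNlen, hNviol⟩ := ih _ hd (H.drop g) rfl
  refine ⟨A ++ N, ?_, ?_, ?_, fun p hp => ?_⟩
  · have h1 := hnet (program base m net g) ⟨H, hlen⟩
    rw [hFM] at h1
    refine (EvalLe.lenSwitch_ge (.call (.pair h1
      (.call (EvalLe.dropExpr (.var rfl) hlen) rfl hN)) rfl (evalLe_append N A))
      (.var rfl) hlen).mono ?_
    rw [List.length_drop]
    have h2 : K * (H.length - g + 1) + K * g = K * (H.length + 1) := by
      rw [← mul_add]; congr 1; omega
    have h3 : K ≤ K * g := Nat.le_mul_of_pos_right _ hg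
    have h4 : A.length ≤ g := by omega
    have h5 : g * (1 + g + 1) = g * (g + 2) := by ring
    omega
  · intro h hh
    rcases List.mem_append.1 hh with hh | hh
    · obtain ⟨i, -, rfl⟩ := List.mem_map.1 hh
      have := i.2.trans_le hlen
      rw [List.getD_eq_getElem _ _ this]
      exact List.getElem_mem this
    · exact List.mem_of_mem_drop (hsub hh)
  · rw [List.length_drop] at hNlen
    rw [List.length_append]
    omega
  · have h1 := hM p fun i hi => hp _ (List.mem_append_left _
      (List.mem_map.2 ⟨i, Finset.mem_toList.2 hi, rfl⟩))
    have h2 := hNviol p fun h hh => hp h (List.mem_append_right _ hh)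
    have h3 : (violators p H).length =
        (violators p (H.take g)).length + (violators p (H.drop g)).length := by
      conv_lhs => rw [← List.take_append_drop g H]
      rw [violators, List.filter_append, List.length_append]
      rfl
    rw [h3, htake, length_violators_ofFn]
    rw [List.length_drop] at h2
    have h4 : 200 * (Finset.univ.filter fun i : Fin g => ¬ Sat p (H.getD i 0)).card ≤ g := by
      convert h1
    omega

/-- One expression for each length computes the optimum of lists of that length. -/
theorem exists_base (k : ℕ) : ∃ e T, ∀ P (Q H : List Triple), Bounding Q → Q.length = 4 →
    H.length = k → EvalLe P [.pair (encList Q) (encList H)] e (encTriple (lexMin (Q ++ H))) T := by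
  obtain ⟨F, ⟨e, T, h⟩, hF⟩ := exists_lexMin_selection
    (α := {a : List Triple × List Triple // a.1.length = 4 ∧ a.2.length = k})
    (env := fun a => [.pair (encList a.1.1) (encList a.1.2)]) (ι := Fin 4 ⊕ Fin k)
    (A := Sum.elim (fun i a => a.1.1.getD i 0) fun i a => a.1.2.getD i 0) (by
      rintro (i | i)
      · exact UT.getD ⟨.fst (.var 0), 2, fun _ _ => .fst (.var rfl)⟩ fun a => i.2.trans_eq a.2.1.symm
      · exact UT.getD ⟨.snd (.var 0), 2, fun _ _ => .snd (.var rfl)⟩ fun a => i.2.trans_eq a.2.2.symm)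
  refine ⟨e, T, fun P Q H hb hQ hH => ?_⟩
  have hmem (l : List Triple) (n : ℕ) (hl : l.length = n) (h : Triple) :
      h ∈ l ↔ ∃ i : Fin n, l.getD i 0 = h := by
    subst hl
    rw [List.mem_iff_get]
    exact exists_congr fun i => by simp
  have := h P ⟨(Q, H), hQ, hH⟩
  rwa [hF _ (Q ++ H) (fun h => by
    simp [hmem Q 4 hQ, hmem H k hH, -List.getD_eq_getElem?_getD]) _ (hb.append H).isLexMin] at this

theorem exists_program : ∃ (base : ℕ → Expr) (m : ℕ) (net : Expr) (g K : ℕ),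
    ∀ Q H : List Triple, Bounding Q → Q.length = 4 →
      EvalLe (program base m net g) [.pair (encList Q) (encList H)] (lexMinBody base m)
        (encTriple (lexMin (Q ++ H))) (K * (H.length + 1)) := by
  obtain ⟨net, g, K₁, hnets⟩ := exists_netsBody
  choose base T hbase using exists_base
  -- From this length on, `g` is below |H|/1000, so after four rounds the subset has at most |H|/100
  -- + g + 4|H|/200 ≤ |H|/32 members.
  obtain ⟨m, hm⟩ : ∃ m, m = 1000 * (g + 1) := ⟨_, rfl⟩
  -- The sum pays for the short lists. The factor 2 reserves half of `K * (H.length + 1)` for the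
  -- work outside the recursion.
  obtain ⟨K, hK⟩ : ∃ K, K = (∑ k ∈ Finset.range m, T k) + 2 * (m * (1 + 1 + m + 1) + (K₁ + 1000)) :=
    ⟨_, rfl⟩
  refine ⟨base, m, net, g, K, fun Q H hQ hQ4 => ?_⟩
  induction hn : H.length using Nat.strong_induction_on generalizing H with
  | _ n ih =>
  subst hn
  by_cases hlen : H.length < m
  · have hT : T H.length ≤ ∑ k ∈ Finset.range m, T k :=
      Finset.single_le_sum (f := T) (fun _ _ => Nat.zero_le _) (Finset.mem_range.2 hlen)
    refine (EvalLe.lenSwitch_lt (.snd (.var rfl)) hlen (T' := T H.length) ?_).mono ?_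
    · rw [zero_add]
      exact hbase _ _ Q H hQ hQ4 rfl
    · have : K ≤ K * (H.length + 1) := Nat.le_mul_of_pos_right _ (by omega)
      omega
  rw [not_lt] at hlen
  obtain ⟨N, hN, hsub, hNlen, hNviol⟩ := hnets base m H
  set B : ℕ → List Triple := fun k => (augment Q H)^[k] N with hB
  have hviol (k : ℕ) : 200 * (violators (lexMin (Q ++ B k)) H).length ≤ H.length :=
    hNviol _ fun h hh => (hQ.append _).isLexMin.1 h
      (List.mem_append_right _ (subset_augment_iterate k hh))
  have hBsucc (k : ℕ) : B (k + 1) = violators (lexMin (Q ++ B k)) H ++ B k :=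
    Function.iterate_succ_apply' _ _ _
  have hBlen : ∀ k, 200 * (B k).length ≤ 200 * N.length + k * H.length := by
    intro k
    induction k with
    | zero => simp [hB]
    | succ k ihk =>
      have := hviol k
      rw [hBsucc, List.length_append, add_mul, one_mul]
      omega
  have hBsmall (k : ℕ) (hk : k ≤ 4) : 32 * (B k).length ≤ H.length := by
    have h1 := hBlen k
    have h2 := Nat.mul_le_mul_right H.length hk
    omega
  have hsolve (k : ℕ) (hk : k ≤ 4) : EvalLe (program base m net g)
      [.pair (encList Q) (encList (B k))] (lexMinBody base m)
      (encTriple (lexMin (Q ++ B k))) (K * ((B k).length + 1)) :=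
    ih _ (by have := hBsmall k hk; omega) (B k) rfl
  have hround (k : ℕ) (hk : k ≤ 4) {e : Expr} {S : ℕ}
      (he : EvalLe (program base m net g) [.pair (encList Q) (encList H)] e (encList (B k)) S) :
      EvalLe (program base m net g) [.pair (encList Q) (encList H)] (roundExpr e)
        (encList (B (k + 1))) (S + K * ((B k).length + 1) + 80 * (H.length + 1) + 50) := by
    rw [hBsucc]
    refine (EvalLe.call (.pair (.fst (.var rfl)) (.pair (.snd (.var rfl)) he)) rfl
      (.letIn (.snd (.snd (.var rfl))) (.call (.pair (.call (.pair (.call (.pair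
        (.fst (.var rfl)) (.var rfl)) rfl (hsolve k hk)) (.fst (.snd (.var rfl)))) rfl
        (evalLe_violators _ H)) (.var rfl)) rfl (evalLe_append (B k) _)))).mono ?_
    have := hviol k
    omega
  have hall : EvalLe (program base m net g) [.pair (encList Q) (encList H)] (lexMinBody base m)
      (encTriple (lexMin (Q ++ B 4))) _ := EvalLe.lenSwitch_ge (.call (.pair (.fst (.var rfl))
    (hround 3 (by omega) (hround 2 (by omega) (hround 1 (by omega) (hround 0 (by omega)
      (.call (.snd (.var rfl)) rfl hN)))))) rfl (hsolve 4 le_rfl)) (.snd (.var rfl)) hlen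
  rw [lexMin_augment_iterate hQ hsub] at hall
  refine hall.mono ?_
  have hKB (k : ℕ) (hk : k ≤ 4) : 32 * (K * ((B k).length + 1)) ≤ K * (H.length + 32) := by
    rw [mul_left_comm]
    exact Nat.mul_le_mul_left _ (by have := hBsmall k hk; omega)
  have h0 := hKB 0 (by omega)
  have h1 := hKB 1 (by omega)
  have h2 := hKB 2 (by omega)
  have h3 := hKB 3 (by omega)
  have h4 := hKB 4 (by omega)
  -- The five recursive calls take at most 5/32 of `K * (H.length + 32)`, and so at most half of `K
  -- * (H.length + 1)`.
  have h5 : 10 * (K * (H.length + 32)) ≤ 16 * (K * (H.length + 1)) := by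
    rw [mul_left_comm, mul_left_comm 16]
    exact Nat.mul_le_mul_left _ (by omega)
  have h6 : 2 * (m * (1 + 1 + m + 1) + (K₁ + 1000)) * (H.length + 1) ≤ K * (H.length + 1) :=
    Nat.mul_le_mul_right _ (by omega)
  have h7 : m * (1 + 1 + m + 1) ≤ m * (1 + 1 + m + 1) * (H.length + 1) :=
    Nat.le_mul_of_pos_right _ (by omega)
  rw [mul_assoc 2, add_mul, add_mul K₁] at h6
  omega

/-! ## From lines to constraints -/

/-- The coefficients of a line. -/
def coeffs (l : Line) : Triple := (l.a, l.b, l.c)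

/-- The signed distance of the point `(x, y)` from a line. -/
noncomputable def signedDist (l : Triple) (x y : ℝ) : ℝ :=
  (l.1 * x + l.2.1 * y + l.2.2) / √(l.1 ^ 2 + l.2.1 ^ 2)

theorem encodeLines_eq (L : List Line) : encodeLines L = encList (L.map coeffs) := by
  induction L with
  | nil => rfl
  | cons l L ih => simp only [encodeLines, ih]; rfl

theorem lpFeasible_iff {L : List Line} {x y z : ℝ} :
    LPFeasible L x y z ↔ ∀ l ∈ L.map coeffs, |signedDist l x y| ≤ z := by
  simp only [LPFeasible, List.forall_mem_map, abs_le', signedDist, coeffs, ← neg_div, neg_add',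
    neg_mul]

theorem forall_sat_doubled_iff {L : List Triple} {p : Triple} :
    (∀ h ∈ doubled L, Sat p h) ↔ ∀ l ∈ L, |signedDist l p.1 p.2.1| ≤ p.2.2 := by
  induction L with
  | nil => simp [doubled]
  | cons l L ih =>
    simp only [doubled, List.forall_mem_cons, ih, ← and_assoc]
    refine and_congr_left fun _ => ?_
    rw [abs_le', signedDist, ← neg_div]
    simp only [Sat, ← pow_two]
    refine and_congr ?_ ?_
    · rw [show ∀ s : ℝ, l.1 / s * p.1 + l.2.1 / s * p.2.1 + l.2.2 / s =
        (l.1 * p.1 + l.2.1 * p.2.1 + l.2.2) / s from fun s => by ring]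
    · rw [show ∀ s : ℝ, (0 - l.1) / s * p.1 + (0 - l.2.1) / s * p.2.1 + (0 - l.2.2) / s =
        -(l.1 * p.1 + l.2.1 * p.2.1 + l.2.2) / s from fun s => by ring]

theorem length_doubled (L : List Triple) : (doubled L).length = 2 * L.length := by
  induction L with
  | nil => rfl
  | cons l L ih => simp only [doubled, List.length_cons, ih]; ring

/-- The signed distances from two crossing lines are affine coordinates of the plane. Since they are
bounded by `z ≤ z₀`, the set is contained in a continuous image of a box. -/
theorem bounding_doubled {l k : Triple} (hD : l.1 * k.2.1 - l.2.1 * k.1 ≠ 0) :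
    Bounding (doubled [l, k]) := by
  intro z₀
  have hnorm (h : Triple) (hh : h.1 ≠ 0 ∨ h.2.1 ≠ 0) : √(h.1 ^ 2 + h.2.1 ^ 2) ≠ 0 := by
    rw [Real.sqrt_ne_zero']
    rcases hh with hh | hh <;> positivity
  have hl : √(l.1 ^ 2 + l.2.1 ^ 2) ≠ 0 := hnorm l (by
    by_contra! h
    simp [h] at hD)
  have hk : √(k.1 ^ 2 + k.2.1 ^ 2) ≠ 0 := hnorm k (by
    by_contra! h
    simp [h] at hD)
  set s := √(l.1 ^ 2 + l.2.1 ^ 2) with hs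
  set t := √(k.1 ^ 2 + k.2.1 ^ 2) with ht
  set D := l.1 * k.2.1 - l.2.1 * k.1
  have hcomp : IsCompact ((fun u : Triple =>
      (((k.2.1 * (s * u.1 - l.2.2) - l.2.1 * (t * u.2.1 - k.2.2)) / D,
        (l.1 * (t * u.2.1 - k.2.2) - k.1 * (s * u.1 - l.2.2)) / D, u.2.2) : Triple)) ''
      Set.Icc (-z₀, -z₀, 0) (z₀, z₀, z₀)) := isCompact_Icc.image (by fun_prop)
  refine hcomp.isBounded.subset ?_
  rintro ⟨x, y, z⟩ ⟨hp, hz⟩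
  have hp := forall_sat_doubled_iff.1 hp
  have h1 := hp l (by simp)
  have h2 := hp k (by simp)
  simp only at h1 h2 hz
  have h1' := abs_le.1 h1
  have h2' := abs_le.1 h2
  refine ⟨(signedDist l x y, signedDist k x y, z), ⟨⟨?_, ?_, ?_⟩, ?_, ?_, hz⟩, ?_⟩
  · show -z₀ ≤ _
    linarith
  · show -z₀ ≤ _
    linarith
  · exact (abs_nonneg _).trans h1
  · show _ ≤ z₀
    linarith
  · show _ ≤ z₀
    linarith
  · have e1 : s * signedDist l x y = l.1 * x + l.2.1 * y + l.2.2 := mul_div_cancel₀ _ hl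
    have e2 : t * signedDist k x y = k.1 * x + k.2.1 * y + k.2.2 := mul_div_cancel₀ _ hk
    simp only [e1, e2]
    refine Prod.ext ?_ (Prod.ext ?_ rfl)
    · simp only
      rw [div_eq_iff hD]
      ring
    · simp only
      rw [div_eq_iff hD]
      ring

theorem transversal_spec (l : Triple) (L : List Triple) :
    (transversal l L ∈ L ∧
      l.1 * (transversal l L).2.1 - l.2.1 * (transversal l L).1 ≠ 0) ∨
    ((∀ h ∈ L, l.1 * h.2.1 - l.2.1 * h.1 = 0) ∧ transversal l L = (0 - l.2.1, l.1, 0)) := by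
  induction L with
  | nil => exact .inr ⟨by simp, rfl⟩
  | cons h L ih =>
    by_cases hD : l.1 * h.2.1 - l.2.1 * h.1 = 0
    · rw [transversal, if_pos hD]
      rcases ih with ⟨h1, h2⟩ | ⟨h1, h2⟩
      · exact .inl ⟨List.mem_cons_of_mem _ h1, h2⟩
      · exact .inr ⟨List.forall_mem_cons.2 ⟨hD, h1⟩, h2⟩
    · rw [transversal, if_neg hD]
      exact .inl ⟨by simp, hD⟩

/-- The added constraints do not raise the least `z`. If the transversal belongs to `L`, they repeat
constraints of `L`. Otherwise all lines are parallel, and a feasible point can slide along them onto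
the added perpendicular without changing its distances from `L`. -/
theorem lpOptimal_of_isLexMin {L : List Line} {l : Line} (hl : l ∈ L) {p : Triple}
    (hp : IsLexMin (doubled [coeffs l, transversal (coeffs l) (L.map coeffs)] ++
      doubled (L.map coeffs)) p) : LPOptimal L p.1 p.2.1 p.2.2 := by
  have hl' : coeffs l ∈ L.map coeffs := List.mem_map_of_mem hl
  refine ⟨lpFeasible_iff.2 (forall_sat_doubled_iff.1 fun h hh =>
    hp.1 h (List.mem_append_right _ hh)), fun x y z hf => ?_⟩
  rw [lpFeasible_iff] at hf
  have key : ∀ x' y', (∀ k ∈ L.map coeffs, |signedDist k x' y'| ≤ z) →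
      |signedDist (transversal (coeffs l) (L.map coeffs)) x' y'| ≤ z → p.2.2 ≤ z := by
    intro x' y' h1 h2
    refine not_lt.1 fun hlt => hp.2 (x', y', z) (fun h hh => ?_) (.inl hlt)
    rcases List.mem_append.1 hh with hh | hh
    · refine forall_sat_doubled_iff.2 (fun k hk => ?_) h hh
      simp only [List.mem_cons, List.not_mem_nil, or_false] at hk
      rcases hk with rfl | rfl
      · exact h1 _ hl'
      · exact h2
    · exact forall_sat_doubled_iff.2 h1 h hh
  rcases transversal_spec (coeffs l) (L.map coeffs) with ⟨h, -⟩ | ⟨h1, h2⟩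
  · exact key x y hf (hf _ h)
  · have hn : (coeffs l).1 ^ 2 + (coeffs l).2.1 ^ 2 ≠ 0 := by
      have : l.a ^ 2 + l.b ^ 2 ≠ 0 := by rcases l.nondegenerate with h | h <;> positivity
      exact this
    set a := (coeffs l).1
    set b := (coeffs l).2.1
    -- The multiple of the direction `(-b, a)` that carries `(x, y)` onto the perpendicular through
    -- the origin.
    set τ := (b * x - a * y) / (a ^ 2 + b ^ 2) with hτ
    have hτ' : τ * (a ^ 2 + b ^ 2) = b * x - a * y := div_mul_cancel₀ _ hn
    refine key (x - b * τ) (y + a * τ) (fun k hk => ?_) ?_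
    · convert hf k hk using 2
      rw [signedDist, signedDist]
      congr 1
      linear_combination τ * h1 k hk
    · rw [h2, signedDist]
      have : (0 - b) * (x - b * τ) + a * (y + a * τ) + 0 = 0 := by
        linear_combination hτ'
      simp only [this, zero_div, abs_zero]
      exact (abs_nonneg _).trans (hf _ hl')

/-! ## Geometry of touching circles -/

theorem abs_signedDist_le_dist (l : Line) (p : Plane) {q : Plane} (hq : q ∈ l.points) :
    |signedDist (coeffs l) (p 0) (p 1)| ≤ dist q p := by
  have hpos : 0 < l.a ^ 2 + l.b ^ 2 := by rcases l.nondegenerate with h | h <;> positivity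
  have hq : l.a * q 0 + l.b * q 1 + l.c = 0 := hq
  simp only [signedDist, coeffs]
  rw [abs_div, abs_of_nonneg (Real.sqrt_nonneg _), EuclideanSpace.dist_eq,
    div_le_iff₀ (Real.sqrt_pos.2 hpos)]
  simp only [Fin.sum_univ_two, Real.dist_eq, sq_abs]
  rw [← Real.sqrt_mul (by positivity)]
  refine Real.abs_le_sqrt ?_
  have : l.a * p 0 + l.b * p 1 + l.c = l.a * (p 0 - q 0) + l.b * (p 1 - q 1) := by
    linear_combination hq
  rw [this]
  -- Cauchy–Schwarz, by way of Lagrange's identity.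
  nlinarith [sq_nonneg (l.a * (p 1 - q 1) - l.b * (p 0 - q 0))]

theorem sphere_inter_points_nonempty (l : Line) (p : Plane) {r : ℝ}
    (h : |signedDist (coeffs l) (p 0) (p 1)| ≤ r) :
    (Metric.sphere p r ∩ l.points).Nonempty := by
  have hpos : 0 < l.a ^ 2 + l.b ^ 2 := by rcases l.nondegenerate with h | h <;> positivity
  have hr : 0 ≤ r := (abs_nonneg _).trans h
  have hs0 := (Real.sqrt_pos.2 hpos).ne'
  have hs2 := Real.sq_sqrt hpos.le
  set s := √(l.a ^ 2 + l.b ^ 2)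
  set d := signedDist (coeffs l) (p 0) (p 1) with hd
  have hds : d * s = l.a * p 0 + l.b * p 1 + l.c := div_mul_cancel₀ _ hs0
  have ht := Real.sq_sqrt (show 0 ≤ r ^ 2 - d ^ 2 by
    have := sq_le_sq' (by linarith [abs_le.1 h]) (le_of_abs_le h)
    linarith)
  set t := √(r ^ 2 - d ^ 2)
  -- The foot of the perpendicular from `p`, moved along the line by half the chord, `t = √(r² -
  -- d²)`.
  refine ⟨!₂[p 0 - (d * l.a + t * l.b) / s, p 1 - (d * l.b - t * l.a) / s], ?_, ?_⟩
  · rw [Metric.mem_sphere, EuclideanSpace.dist_eq, Real.sqrt_eq_iff_mul_self_eq (by positivity) hr]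
    simp only [Fin.sum_univ_two, Real.dist_eq, sq_abs, Matrix.cons_val_zero, Matrix.cons_val_one]
    have e1 : p 0 - (d * l.a + t * l.b) / s - p 0 = -((d * l.a + t * l.b) / s) := by ring
    have e2 : p 1 - (d * l.b - t * l.a) / s - p 1 = -((d * l.b - t * l.a) / s) := by ring
    rw [e1, e2, neg_sq, neg_sq, div_pow, div_pow, ← add_div, div_eq_iff (pow_ne_zero 2 hs0), hs2]
    linear_combination (l.a ^ 2 + l.b ^ 2) * ht
  · show l.a * (p 0 - (d * l.a + t * l.b) / s) + l.b * (p 1 - (d * l.b - t * l.a) / s) + l.c = 0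
    field_simp
    linear_combination (-s) * hds + d * hs2

theorem isTouchingCircle_iff {L : List Line} {p : Plane} {r : ℝ} :
    IsTouchingCircle L p r ↔ 0 ≤ r ∧ LPFeasible L (p 0) (p 1) r := by
  rw [IsTouchingCircle, lpFeasible_iff, List.forall_mem_map]
  refine and_congr_right fun _ => forall₂_congr fun l _ => ⟨?_, sphere_inter_points_nonempty l p⟩
  rintro ⟨q, hq, hql⟩
  exact (abs_signedDist_le_dist l p hql).trans_eq hq

theorem nonneg_of_lpFeasible {L : List Line} (hL : L ≠ []) {x y z : ℝ} (h : LPFeasible L x y z) :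
    0 ≤ z := by
  obtain ⟨l, hl⟩ := List.exists_mem_of_ne_nil L hL
  exact (abs_nonneg _).trans (lpFeasible_iff.1 h _ (List.mem_map_of_mem hl))

theorem isMinTouchingCircle_of_lpOptimal {L : List Line} (hL : L ≠ []) {x y r : ℝ}
    (h : LPOptimal L x y r) : IsMinTouchingCircle L !₂[x, y] r :=
  ⟨isTouchingCircle_iff.2 ⟨nonneg_of_lpFeasible hL h.1, h.1⟩, fun _ _ hq =>
    h.2 _ _ _ (isTouchingCircle_iff.1 hq).2⟩

/-! ### The circle as a tour -/

/-- A chord is no longer than its arc: its square is 2r²(1 - cos θ) ≤ r²θ². -/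
theorem dist_circleCurve_le (p : Plane) {r : ℝ} (hr : 0 ≤ r) (s t : ℝ) :
    dist (circleCurve p r s) (circleCurve p r t) ≤ 2 * Real.pi * r * dist s t := by
  have hpi := Real.pi_pos
  rw [EuclideanSpace.dist_eq]
  refine Real.sqrt_le_iff.2 ⟨by positivity, ?_⟩
  simp only [circleCurve, Fin.sum_univ_two, Real.dist_eq, sq_abs, PiLp.add_apply, PiLp.smul_apply,
    smul_eq_mul, Matrix.cons_val_zero, Matrix.cons_val_one, mul_pow]
  have h := Real.one_sub_sq_div_two_le_cos (x := 2 * Real.pi * s - 2 * Real.pi * t)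
  rw [Real.cos_sub] at h
  have h1 := Real.sin_sq_add_cos_sq (2 * Real.pi * s)
  have h2 := Real.sin_sq_add_cos_sq (2 * Real.pi * t)
  have h3 := mul_le_mul_of_nonneg_left h (sq_nonneg r)
  nlinarith

theorem curveLength_circleCurve_le (p : Plane) {r : ℝ} (hr : 0 ≤ r) :
    curveLength (circleCurve p r) ≤ ENNReal.ofReal (2 * Real.pi * r) := by
  have hlip : LipschitzWith (2 * Real.pi * r).toNNReal (circleCurve p r) :=
    LipschitzWith.of_dist_le_mul fun s t => by
      rw [Real.coe_toNNReal _ (by positivity)]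
      exact dist_circleCurve_le p hr s t
  refine ((LipschitzOnWith.comp_eVariationOn_le (hlip.lipschitzOnWith (s := Set.univ))
    (g := id) (s := Set.Icc 0 1) (Set.mapsTo_univ _ _))).trans ?_
  have := (monotoneOn_id (s := Set.Icc (0 : ℝ) 1)).eVariationOn_eq
    (a := 0) (b := 1) (by simp) (by simp)
  rw [Set.inter_self] at this
  rw [this]
  simp [ENNReal.ofReal]

theorem sphere_subset_circleCurve (p : Plane) {r : ℝ} {q : Plane} (hq : q ∈ Metric.sphere p r) :
    ∃ t ∈ Set.Icc (0 : ℝ) 1, circleCurve p r t = q := by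
  have hpi := Real.pi_pos
  set w : ℂ := ⟨q 0 - p 0, q 1 - p 1⟩ with hw
  have hnorm : ‖w‖ = r := by
    rw [Metric.mem_sphere, EuclideanSpace.dist_eq] at hq
    rw [← hq, Complex.norm_eq_sqrt_sq_add_sq]
    simp [Fin.sum_univ_two, Real.dist_eq, hw]
  have hcos : r * Real.cos w.arg = q 0 - p 0 := by
    rw [← hnorm, Complex.norm_mul_cos_arg]
  have hsin : r * Real.sin w.arg = q 1 - p 1 := by
    rw [← hnorm, Complex.norm_mul_sin_arg]
  obtain ⟨t, ht, hc, hs⟩ : ∃ t ∈ Set.Icc (0 : ℝ) 1, Real.cos (2 * Real.pi * t) = Real.cos w.arg ∧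
      Real.sin (2 * Real.pi * t) = Real.sin w.arg := by
    have h1 := Complex.neg_pi_lt_arg w
    have h2 := Complex.arg_le_pi w
    rcases le_or_gt 0 w.arg with h | h
    · refine ⟨w.arg / (2 * Real.pi), ⟨by positivity, ?_⟩, ?_⟩
      · rw [div_le_one (by positivity)]
        linarith
      · rw [mul_div_cancel₀ _ (by positivity)]
        exact ⟨rfl, rfl⟩
    · refine ⟨(w.arg + 2 * Real.pi) / (2 * Real.pi), ⟨?_, ?_⟩, ?_⟩
      · exact div_nonneg (by linarith) (by positivity)
      · rw [div_le_one (by positivity)]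
        linarith
      · rw [mul_div_cancel₀ _ (by positivity)]
        exact ⟨Real.cos_add_two_pi _, Real.sin_add_two_pi _⟩
  refine ⟨t, ht, ?_⟩
  ext i
  fin_cases i
  · simp [circleCurve, hc, hcos]
  · simp [circleCurve, hs, hsin]

theorem isTour_of_isTouchingCircle {L : List Line} {p : Plane} {r : ℝ}
    (h : IsTouchingCircle L p r) : IsTour L (circleCurve p r) := by
  refine ⟨⟨?_, by simp [circleCurve]⟩, fun l hl => ?_⟩
  · have : LipschitzWith (2 * Real.pi * r).toNNReal (circleCurve p r) :=
      LipschitzWith.of_dist_le_mul fun s t => by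
        rw [Real.coe_toNNReal _ (mul_nonneg (by positivity) h.1)]
        exact dist_circleCurve_le p h.1 s t
    exact this.continuous.continuousOn
  · obtain ⟨q, hq, hql⟩ := h.2 l hl
    obtain ⟨t, ht, rfl⟩ := sphere_subset_circleCurve p hq
    exact ⟨t, ht, hql⟩

/-! ### Tours are at least as long as four radii -/

theorem dist_add_dist_le_variation {γ : ℝ → Plane} {a t b : ℝ} (hat : a ≤ t) (htb : t ≤ b)
    (hfin : eVariationOn γ (Set.Icc a b) ≠ ⊤) :
    dist (γ a) (γ t) + dist (γ t) (γ b) ≤ (eVariationOn γ (Set.Icc a b)).toReal := by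
  have h1 := eVariationOn.edist_le γ (s := Set.Icc a t) (x := a) (y := t) ⟨le_rfl, hat⟩
    ⟨hat, le_rfl⟩
  have h2 := eVariationOn.edist_le γ (s := Set.Icc t b) (x := t) (y := b) ⟨le_rfl, htb⟩
    ⟨htb, le_rfl⟩
  have h3 := eVariationOn.Icc_add_Icc γ (s := Set.univ) hat htb (Set.mem_univ _)
  simp only [Set.univ_inter] at h3
  rw [dist_edist, dist_edist, ← ENNReal.toReal_add (edist_ne_top _ _) (edist_ne_top _ _)]
  exact ENNReal.toReal_mono hfin (h3 ▸ add_le_add h1 h2)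

/-- A closed curve lies in a disc whose radius is a quarter of its length. -/
theorem exists_disc_of_isClosedCurve {γ : ℝ → Plane} (hγ : IsClosedCurve γ)
    (hfin : curveLength γ ≠ ⊤) :
    ∃ m, ∀ t ∈ Set.Icc (0 : ℝ) 1, dist (γ t) m ≤ (curveLength γ).toReal / 4 := by
  obtain ⟨hcont, hclosed⟩ := hγ
  set ℓ := (curveLength γ).toReal with hℓ
  have hsub {a b : ℝ} (ha : 0 ≤ a) (hb : b ≤ 1) : eVariationOn γ (Set.Icc a b) ≠ ⊤ :=
    ne_top_of_le_ne_top hfin (eVariationOn.mono γ (Set.Icc_subset_Icc ha hb))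
  set f : ℝ → ℝ := fun t => (eVariationOn γ (Set.Icc 0 t)).toReal with hf
  have hadd {t : ℝ} (ht : t ∈ Set.Icc (0 : ℝ) 1) :
      f t + (eVariationOn γ (Set.Icc t 1)).toReal = ℓ := by
    have h := eVariationOn.Icc_add_Icc γ (s := Set.univ) ht.1 ht.2 (Set.mem_univ _)
    simp only [Set.univ_inter] at h
    rw [hf, hℓ, curveLength, ← h, ENNReal.toReal_add (hsub le_rfl ht.2) (hsub ht.1 le_rfl)]
  -- Its supremum `s` plays the part of the halfway point. Continuity of the length function is not
  -- needed: `s` is approached by times in `S` from the left and by times outside `S` from the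
  -- right.
  set S : Set ℝ := {t | t ∈ Set.Icc (0 : ℝ) 1 ∧ f t ≤ ℓ / 2} with hS
  have h0 : (0 : ℝ) ∈ S := by
    refine ⟨by simp, ?_⟩
    have : f 0 = 0 := by simp [hf, eVariationOn.subsingleton]
    rw [this]
    have : 0 ≤ ℓ := ENNReal.toReal_nonneg
    positivity
  have hbdd : BddAbove S := ⟨1, fun t ht => ht.1.2⟩
  set s := sSup S with hs
  have hs0 : 0 ≤ s := le_csSup hbdd h0
  have hs1 : s ≤ 1 := csSup_le ⟨0, h0⟩ fun t ht => ht.1.2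
  have hsI : s ∈ Set.Icc (0 : ℝ) 1 := ⟨hs0, hs1⟩
  have near {φ : ℝ → ℝ} (hφ : ContinuousOn φ (Set.Icc 0 1)) (h : ℓ / 2 < φ s) :
      ∃ δ > 0, ∀ u ∈ Set.Icc (0 : ℝ) 1, |u - s| < δ → ℓ / 2 < φ u := by
    have := (hφ s hsI).eventually_const_lt h
    rw [eventually_nhdsWithin_iff, Metric.eventually_nhds_iff] at this
    obtain ⟨δ, hδ, hball⟩ := this
    exact ⟨δ, hδ, fun u hu hus => hball hus hu⟩
  have hsum : ∀ t ∈ Set.Icc (0 : ℝ) 1, dist (γ 0) (γ t) + dist (γ t) (γ s) ≤ ℓ / 2 := by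
    intro t ht
    by_contra! hc
    rcases le_or_gt t s with hts | hts
    · have hmin : ContinuousOn (fun u => γ (min t u)) (Set.Icc 0 1) :=
        hcont.comp (by fun_prop) fun u hu => ⟨le_min ht.1 hu.1, (min_le_left _ _).trans ht.2⟩
      obtain ⟨δ, hδ, hnear⟩ := near
        (φ := fun u => dist (γ 0) (γ (min t u)) + dist (γ (min t u)) (γ u))
        ((continuous_dist.comp_continuousOn (continuousOn_const.prodMk hmin)).add
          (continuous_dist.comp_continuousOn (hmin.prodMk hcont))) (by simpa [min_eq_left hts])
      obtain ⟨u, hu, hus⟩ := exists_lt_of_lt_csSup ⟨0, h0⟩ (show s - δ < sSup S by linarith)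
      have hus' : u ≤ s := le_csSup hbdd hu
      have h1 := hnear u hu.1 (by rw [abs_lt]; constructor <;> linarith)
      have h2 := dist_add_dist_le_variation (γ := γ) (le_min ht.1 hu.1.1) (min_le_right t u)
        (hsub le_rfl hu.1.2)
      exact absurd (h2.trans hu.2) (not_le.2 h1)
    -- After `s`, the closed curve is followed to its end `γ 1 = γ 0`; from a time `u > s`, less
    -- than half of the length remains.
    · obtain ⟨δ, hδ, hnear⟩ := near (φ := fun u => dist (γ u) (γ t) + dist (γ t) (γ 1))
        (by fun_prop) (by
          rw [dist_comm, ← hclosed, dist_comm (γ t) (γ 0)]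
          linarith)
      obtain ⟨u, hsu, hu⟩ := exists_between (show s < min t (s + δ) from lt_min hts (by linarith))
      obtain ⟨hut, hud⟩ := lt_min_iff.1 hu
      have huI : u ∈ Set.Icc (0 : ℝ) 1 := ⟨by linarith, by linarith [ht.2]⟩
      have h1 := hnear u huI (by rw [abs_lt]; constructor <;> linarith)
      have h2 := dist_add_dist_le_variation (γ := γ) hut.le ht.2 (hsub huI.1 le_rfl)
      have h3 : ℓ / 2 < f u := by
        by_contra! h
        exact absurd (le_csSup hbdd ⟨huI, h⟩) (not_le.2 hsu)
      have h4 := hadd huI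
      linarith
  -- The distance from `γ t` to the midpoint is at most the mean of its distances to `γ 0` and `γ
  -- s`, hence at most ℓ/4.
  refine ⟨midpoint ℝ (γ 0) (γ s), fun t ht => ?_⟩
  have h1 := dist_midpoint_midpoint_le (γ t) (γ t) (γ 0) (γ s)
  rw [midpoint_self, dist_comm (γ t) (γ 0)] at h1
  linarith [hsum t ht]

theorem ofReal_le_optLength {L : List Line} {p : Plane} {r : ℝ}
    (h : IsMinTouchingCircle L p r) : ENNReal.ofReal (4 * r) ≤ optLength L := by
  refine le_iInf₂ fun γ hγ => ?_
  by_cases hfin : curveLength γ = ⊤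
  · simp [hfin]
  obtain ⟨m, hm⟩ := exists_disc_of_isClosedCurve hγ.1 hfin
  refine ENNReal.ofReal_le_of_le_toReal ?_
  have := h.2 m ((curveLength γ).toReal / 4) ⟨by positivity, fun l hl => by
    obtain ⟨t, ht, htl⟩ := hγ.2 l hl
    exact sphere_inter_points_nonempty l m ((abs_signedDist_le_dist l m htl).trans (hm t ht))⟩
  linarith

theorem curveLength_le_of_isMinTouchingCircle {L : List Line} {p : Plane} {r : ℝ}
    (h : IsMinTouchingCircle L p r) :
    curveLength (circleCurve p r) ≤ ENNReal.ofReal (Real.pi / 2) * optLength L :=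
  calc curveLength (circleCurve p r) ≤ ENNReal.ofReal (2 * Real.pi * r) :=
        curveLength_circleCurve_le p h.1.1
    _ = ENNReal.ofReal (Real.pi / 2) * ENNReal.ofReal (4 * r) := by
        rw [← ENNReal.ofReal_mul (by positivity)]
        congr 1
        ring
    _ ≤ _ := by gcongr; exact ofReal_le_optLength h

end LineTour

open LineTour

theorem mainTheorem4 :
    ∃ (P : TSPNLines.Program) (C : ℕ), ∀ L : List TSPNLines.Line, L ≠ [] →
      ∃ (x y r : ℝ) (t : ℕ),
        TSPNLines.RunsIn P (TSPNLines.encodeLines L) (TSPNLines.encodeCircle x y r) t ∧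
        t ≤ C * L.length ∧
        TSPNLines.LPOptimal L x y r ∧
        TSPNLines.IsMinTouchingCircle L !₂[x, y] r ∧
        TSPNLines.IsTour L (TSPNLines.circleCurve !₂[x, y] r) ∧
        TSPNLines.curveLength (TSPNLines.circleCurve !₂[x, y] r) ≤
          ENNReal.ofReal (Real.pi / 2) * TSPNLines.optLength L := by
  obtain ⟨base, m, net, g, K, hK⟩ := exists_program
  -- For `n` lines there are `2n` constraints, and `K * (2n + 1) ≤ 3 * K * n` as `n ≥ 1`; 1000
  -- covers the linear preprocessing.
  refine ⟨program base m net g, 1000 + 3 * K, fun L hL => ?_⟩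
  obtain ⟨l, L', rfl⟩ := List.exists_cons_of_ne_nil hL
  set A := (l :: L').map coeffs with hA
  set k := transversal (coeffs l) A with hk
  have hnd : (coeffs l).1 ^ 2 + (coeffs l).2.1 ^ 2 ≠ 0 := by
    have : l.a ^ 2 + l.b ^ 2 ≠ 0 := by rcases l.nondegenerate with h | h <;> positivity
    exact this
  have hD : (coeffs l).1 * k.2.1 - (coeffs l).2.1 * k.1 ≠ 0 := by
    rcases transversal_spec (coeffs l) A with ⟨-, h⟩ | ⟨-, h⟩
    · exact h
    · rw [hk, h]
      intro h0
      exact hnd (by linear_combination h0)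
  have hkne : k.1 ≠ 0 ∨ k.2.1 ≠ 0 := by
    by_contra! h
    simp [h] at hD
  have hAne : ∀ h ∈ A, h.1 ≠ 0 ∨ h.2.1 ≠ 0 := by
    rw [hA, List.forall_mem_map]
    exact fun j _ => j.nondegenerate
  have hQ := bounding_doubled hD
  set p := lexMin (doubled [coeffs l, k] ++ doubled A) with hp
  have hopt : LPOptimal (l :: L') p.1 p.2.1 p.2.2 :=
    lpOptimal_of_isLexMin (by simp) (hQ.append _).isLexMin
  have hmin := isMinTouchingCircle_of_lpOptimal hL hopt
  have hrun : EvalLe (program base m net g) [encList A] mainBody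
      (encTriple p) _ := .call (.pair (.call (.pair (.fst (.var rfl)) (.pair (.call (.pair (.fst (.var rfl))
      (.var rfl)) rfl (evalLe_transversal _ A)) .nil)) rfl (evalLe_doubled [coeffs l, k] (by
        simpa using ⟨l.nondegenerate, hkne⟩)))
      (.call (.var rfl) rfl (evalLe_doubled A hAne))) rfl (hK _ _ hQ (by simp [length_doubled]))
  rw [hA, ← encodeLines_eq] at hrun
  obtain ⟨t, ht, hrun⟩ := hrun
  refine ⟨p.1, p.2.1, p.2.2, t, ⟨mainBody, rfl, hrun⟩, ht.trans ?_, hopt, hmin,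
    isTour_of_isTouchingCircle hmin.1, curveLength_le_of_isMinTouchingCircle hmin⟩
  have hAlen : A.length = L'.length + 1 := by simp [hA]
  rw [length_doubled, hAlen]
  simp only [List.length_cons, List.length_nil]
  have : K * (2 * (L'.length + 1) + 1) ≤ K * (3 * (L'.length + 1)) :=
    Nat.mul_le_mul_left _ (by omega)
  rw [add_mul, mul_comm 3 K, mul_assoc]
  omega
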